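/- Long virtual knots are considered up to Reidemeister equivalence (equivalently, as signed Gauss diagrams on an oriented line modulo the Reidemeister moves). For a long virtual knot $K$, let $sg_1(K)$ be the minimal genus $g$ of a closed connected oriented surface $\Sigma_g$ on which some diagram of $K$ can be realized as a closed curve with real crossings only and with a basepoint corresponding to $\pm\infty$. Let $sg_2(K)$ be the minimal genus $g$ of a compact connected oriented surface $\Sigma_{g,2}$ with two boundary components on which some diagram of $K$ can be realized, with real crossings only, as an arc whose two endpoints lie on distinct boundary components. For $i\in\{1,2\}$ and an integer $g\ge 0$ put $\mathcal{K}_i(g)=\{K \mid sg_i(K)\le g\}$. **Theorem.** We have 1. $\mathcal{K}_1(0)\ne\mathcal{K}_2(0)$, 2. $\mathcal{K}_2(0)\ne\mathcal{K}_1(1)$, 3. $\mathcal{K}_1(1)\ne\mathcal{K}_2(1)$. Moreover, in each case infinitely many long virtual knots realize the difference: the sets $\mathcal{K}_2(0)\setminus\mathcal{K}_1(0)$, $\mathcal{K}_1(1)\setminus\mathcal{K}_2(0)$ and $\mathcal{K}_2(1)\setminus\mathcal{K}_1(1)$ are infinite. -/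

import Mathlib

/-- A letter of a signed Gauss word: one passage through the real crossing `label`,
along the over-strand (`isOver = true`) or the under-strand (`isOver = false`).
The sign of the crossing is recorded at both of its passages. -/
@[ext] structure GaussLetter where
  label : ℕ
  isOver : Bool
  sign : ℤˣ

namespace GaussLetter

/-- The other passage through the same crossing. -/
def other (x : GaussLetter) : GaussLetter := ⟨x.label, !x.isOver, x.sign⟩

/-- Renaming of the crossings. -/
def relabel (f : Equiv.Perm ℕ) (x : GaussLetter) : GaussLetter := ⟨f x.label, x.isOver, x.sign⟩

/-- `x.side = 1` if, seen while travelling along the passage `x`, the other strand of the crossing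
runs from right to left, and `x.side = -1` if it runs from left to right. -/
def side (x : GaussLetter) : ℤˣ := if x.isOver then x.sign else -x.sign

end GaussLetter

/-- A diagram of a long virtual knot, given by its signed Gauss word, i.e. by a Gauss diagram on
an oriented line: the list of the passages through the real crossings in the order in which they
are met from `-∞` to `+∞`.  Every crossing that occurs is met exactly twice, once over and once
under.  Virtual crossings leave no trace in the Gauss word. -/
structure LongGaussDiagram where
  word : List GaussLetter
  nodup : word.Nodup
  other_mem : ∀ x ∈ word, x.other ∈ word
  sign_eq : ∀ x ∈ word, ∀ y ∈ word, x.label = y.label → x.sign = y.sign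

/-- The pair `x, y` in this order if `s = 1`, and in the order `y, x` if `s = -1`. -/
def orderedPair (s : ℤˣ) (x y : GaussLetter) : List GaussLetter :=
  if s = 1 then [x, y] else [y, x]

/-- Renaming of crossings and the (real) Reidemeister moves on signed Gauss words, with all
choices of orientations and signs, and with the strands involved met in any order.
The virtual and the mixed Reidemeister moves do not change the Gauss word. -/
inductive GaussMove : List GaussLetter → List GaussLetter → Prop
  | relabel (f : Equiv.Perm ℕ) (w : List GaussLetter) :
      GaussMove w (w.map (GaussLetter.relabel f))
  /-- Creation of a kink. -/
  | reidemeister1 (u₀ u₁ : List GaussLetter) (a : ℕ) (e : ℤˣ) (o : Bool) :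
      GaussMove (u₀ ++ u₁) (u₀ ++ [⟨a, o, e⟩, ⟨a, !o, e⟩] ++ u₁)
  /-- Creation of two crossings of opposite signs between two strands, one of which passes over
  the other one twice; the strands run in parallel or in opposite directions. -/
  | reidemeister2 (u₀ u₁ u₂ p q : List GaussLetter) (a b : ℕ) (e : ℤˣ) (o : Bool)
      (hp : p = [⟨a, o, e⟩, ⟨b, o, -e⟩])
      (hq : q = [⟨a, !o, e⟩, ⟨b, !o, -e⟩] ∨ q = [⟨b, !o, -e⟩, ⟨a, !o, e⟩]) :
      GaussMove (u₀ ++ u₁ ++ u₂) (u₀ ++ p ++ u₁ ++ q ++ u₂)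
  /-- Three strands, top, middle and bottom, form a triangle, with the crossings
  `a` (top over middle), `b` (top over bottom) and `c` (middle over bottom) of signs
  `ea`, `eb`, `ec`; the move reverses the order of the two crossings on each of the strands.
  For three oriented lines in the oriented plane the three orders are determined by the signs
  up to simultaneous reversal, which is the choice of `d`. -/
  | reidemeister3 (u₀ u₁ u₂ u₃ s₁ s₂ s₃ : List GaussLetter) (a b c : ℕ) (ea eb ec d : ℤˣ)
      (hs : List.Perm [s₁, s₂, s₃]
        [orderedPair (d * eb) ⟨a, true, ea⟩ ⟨b, true, eb⟩,
         orderedPair (d * ec) ⟨a, false, ea⟩ ⟨c, true, ec⟩,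
         orderedPair (d * ea * eb * ec) ⟨b, false, eb⟩ ⟨c, false, ec⟩]) :
      GaussMove (u₀ ++ s₁ ++ u₁ ++ s₂ ++ u₂ ++ s₃ ++ u₃)
        (u₀ ++ s₁.reverse ++ u₁ ++ s₂.reverse ++ u₂ ++ s₃.reverse ++ u₃)

/-- A long virtual knot: a class of diagrams under the equivalence relation generated by the
moves (`Quot` identifies along the generated equivalence relation). -/
def LongVirtualKnot : Type :=
  Quot fun D D' : LongGaussDiagram => GaussMove D.word D'.word

namespace LongGaussDiagram

/-- The long virtual knot presented by a diagram. -/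
def toKnot (D : LongGaussDiagram) : LongVirtualKnot := Quot.mk _ D

/-- The number of real crossings. -/
def numCrossings (D : LongGaussDiagram) : ℕ := D.word.countP fun x => x.isOver

/-- The `m` passages cut the diagram into `m + 1` edges; edge `k` ends at passage `k` and edge
`k + 1` starts there.  The dart `(k, true)` is edge `k` with its orientation, the dart
`(k, false)` is edge `k` with the reversed orientation.  A dart also stands for the left bank
of the edge with respect to the direction of the dart. -/
abbrev Dart (D : LongGaussDiagram) : Type := Fin (D.word.length + 1) × Bool

/-- Walking along the left bank of the diagram through a crossing, i.e. turning left, on any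
oriented surface on which the diagram is drawn.  Here `i` and `j` are the two passages through
the crossing, and one arrives along the strand of passage `i`, forwards (on edge `i`) or
backwards (on edge `i + 1`). -/
inductive TurnLeft (D : LongGaussDiagram) : D.Dart → D.Dart → Prop
  | fwd_pos (i j : Fin D.word.length) (h : D.word.get j = (D.word.get i).other)
      (hi : (D.word.get i).side = 1) : TurnLeft D (i.castSucc, true) (j.succ, true)
  | fwd_neg (i j : Fin D.word.length) (h : D.word.get j = (D.word.get i).other)
      (hi : (D.word.get i).side = -1) : TurnLeft D (i.castSucc, true) (j.castSucc, false)
  | bwd_pos (i j : Fin D.word.length) (h : D.word.get j = (D.word.get i).other)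
      (hi : (D.word.get i).side = 1) : TurnLeft D (i.succ, false) (j.castSucc, false)
  | bwd_neg (i j : Fin D.word.length) (h : D.word.get j = (D.word.get i).other)
      (hi : (D.word.get i).side = -1) : TurnLeft D (i.succ, false) (j.succ, true)

/-- Walking along the left bank when the two ends of the diagram are joined at a basepoint. -/
inductive ClosedStep (D : LongGaussDiagram) : D.Dart → D.Dart → Prop
  | turn {x y : D.Dart} (h : D.TurnLeft x y) : ClosedStep D x y
  | through_fwd : ClosedStep D (Fin.last _, true) (0, true)
  | through_bwd : ClosedStep D (0, false) (Fin.last _, false)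

/-- Walking along the left bank when the two ends of the diagram lie on two distinct boundary
circles of the surface: at an end one runs once along that boundary circle and returns on the
other bank of the same edge. -/
inductive TangleStep (D : LongGaussDiagram) : D.Dart → D.Dart → Prop
  | turn {x y : D.Dart} (h : D.TurnLeft x y) : TangleStep D x y
  | around_end : TangleStep D (Fin.last _, true) (Fin.last _, false)
  | around_start : TangleStep D (0, false) (0, true)

/-- The boundary circles of a regular neighbourhood of the closed diagram with basepoint, drawn on
an oriented surface. -/
def ClosedCircle (D : LongGaussDiagram) : Type := Quot D.ClosedStep

/-- The boundary circles of a regular neighbourhood of the union of the diagram and of the two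
boundary circles of the surface on which its ends lie, other than these two circles themselves. -/
def TangleCircle (D : LongGaussDiagram) : Type := Quot D.TangleStep

end LongGaussDiagram

/-- The complementary regions of a regular neighbourhood with set of free boundary circles `C` in
a connected surface: finitely many compact connected oriented surfaces of arbitrary genus, each
glued to the neighbourhood along a nonempty set of the circles in `C`. -/
structure ComplementaryRegions (C : Type) where
  numRegions : ℕ
  region : C → Fin numRegions
  region_surjective : Function.Surjective region
  regionGenus : Fin numRegions → ℕ

/-- The sum of the Euler characteristics `2 - 2 * genus - (number of boundary circles)` of the
regions. -/
noncomputable def ComplementaryRegions.eulerChar {C : Type} (R : ComplementaryRegions C) : ℤ :=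
  ∑ r, (2 - 2 * (R.regionGenus r : ℤ) - (Nat.card {c : C // R.region c = r} : ℤ))

/-- A realization `(Σ_g, D)` of the diagram `D`, as a closed curve with a basepoint, on a closed
connected oriented surface of genus `g`.  The surface is the union of a regular neighbourhood of
the curve, whose Euler characteristic is minus the number of crossings, and of the complementary
regions; the regions need not be disks.  The genus is determined by `χ(Σ_g) = 2 - 2 * g`. -/
structure ClosedRealization (D : LongGaussDiagram) where
  regions : ComplementaryRegions D.ClosedCircle
  genus : ℕ
  euler : (2 : ℤ) - 2 * genus = -(D.numCrossings : ℤ) + regions.eulerChar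

/-- A realization `(Σ_{g,2}, D)` of the diagram `D`, as an arc joining the two boundary circles of
a compact connected oriented surface of genus `g` with two boundary circles.  The surface is the
union of a regular neighbourhood of the arc and of the boundary, whose Euler characteristic is
minus the number of crossings minus one, and of the complementary regions.
The genus is determined by `χ(Σ_{g,2}) = 2 - 2 * g - 2`. -/
structure TangleRealization (D : LongGaussDiagram) where
  regions : ComplementaryRegions D.TangleCircle
  genus : ℕ
  euler : (2 : ℤ) - 2 * genus - 2 = (-(D.numCrossings : ℤ) - 1) + regions.eulerChar

namespace LongVirtualKnot

/-- The 1-supporting genus: the least genus of a realization, on a closed surface, of a diagram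
of `K`. -/
noncomputable def sg1 (K : LongVirtualKnot) : ℕ∞ :=
  ⨅ (D : LongGaussDiagram) (_ : D.toKnot = K) (S : ClosedRealization D), (S.genus : ℕ∞)

/-- The 2-supporting genus: the least genus of a realization, on a surface with two boundary
circles, of a diagram of `K`. -/
noncomputable def sg2 (K : LongVirtualKnot) : ℕ∞ :=
  ⨅ (D : LongGaussDiagram) (_ : D.toKnot = K) (S : TangleRealization D), (S.genus : ℕ∞)

/-- The set of long virtual knots of 1-supporting genus at most `g`. -/
def K1 (g : ℕ) : Set LongVirtualKnot := {K | K.sg1 ≤ g}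

/-- The set of long virtual knots of 2-supporting genus at most `g`. -/
def K2 (g : ℕ) : Set LongVirtualKnot := {K | K.sg2 ≤ g}

end LongVirtualKnot

/-! Each crossing cuts out of the long knot a loop, running from its first passage to its second.
Weight this loop by the sign of the crossing times an arbitrary function `φ` of its type (over or
under first) and its index, sum over the crossings, and add `c` copies of the whole knot.
`loopPairing` is four times the intersection number of two such cycles. It is invariant under
Reidemeister moves: a kink contributes two cancelling terms, the two loops born in a second move
have opposite weights, and in a third move the changes at the three vertices cancel.

The supporting genus bounds the rank of the pairing. On a closed surface of genus `g` the
intersection form has rank at most `2g` on all these cycles, the whole knot included. On a surface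
with two boundary circles the knot is an arc, and the bound `2g` holds only for the cycles with `c =
0`. The combinatorial form is `card_circles_le`: cycles are flows on the edges, combinations of
boundary circles are flows that pair trivially with the test cycles, and comparing ranks bounds the
number of circles.

Hence a weighted sum of loops that meets the knot excludes `K1 0`; two such sums that meet each
other exclude `K2 0`; and two that meet each other, with a third that is orthogonal to both and
meets the knot, exclude `K1 1`. The examples are two strands twisted around each other with `N + 1`
crossings, `N` odd. With all signs equal the diagram lies in an annulus; reversing the last sign
puts it on a torus; appending the annular diagram with two crossings to the latter gives the third
family. Pairings equal to `-2 * (N + 1)` tell the members of each family apart. The genera are found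
by exhibiting enough boundary circles, the same rank inequality showing that there are no more. -/

instance : DecidableEq GaussLetter := fun x y =>
  decidable_of_iff (x.label = y.label ∧ x.isOver = y.isOver ∧ x.sign = y.sign)
    GaussLetter.ext_iff.symm

namespace GaussLetter

@[simp] theorem other_other (x : GaussLetter) : x.other.other = x := by simp [other]

theorem other_ne (x : GaussLetter) : x.other ≠ x := by
  intro h; have := congrArg isOver h; simp [other] at this

theorem side_other (x : GaussLetter) : x.other.side = -x.side := by
  cases h : x.isOver <;> simp [side, other, h]

@[simp] theorem relabel_other (f : Equiv.Perm ℕ) (x : GaussLetter) :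
    (x.relabel f).other = x.other.relabel f := rfl

theorem relabel_injective (f : Equiv.Perm ℕ) : Function.Injective (relabel f) := by
  intro x y h
  simp only [relabel, mk.injEq, EmbeddingLike.apply_eq_iff_eq] at h
  exact GaussLetter.ext h.1 h.2.1 h.2.2

@[simp] theorem relabel_side (f : Equiv.Perm ℕ) (x : GaussLetter) :
    (x.relabel f).side = x.side := rfl

end GaussLetter

/-! ### Level functions, weighted sums of loops and their pairing -/

namespace GaussWord

open GaussLetter

variable {d d' : GaussLetter → ℤ} {c c' : ℤ} {u v w s : List GaussLetter} {x y : GaussLetter}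

/-- A function `d` on the letters and a start value `c` give a level to each edge, which jumps
by `d x` at the passage `x`.  This is the sum of the levels before and after the passage `x`. -/
def doubleLevel (d : GaussLetter → ℤ) : ℤ → List GaussLetter → GaussLetter → ℤ
  | _, [], _ => 0
  | c, y :: w, x => if x = y then 2 * c + d y else doubleLevel d (c + d y) w x

theorem doubleLevel_append_left (h : x ∈ u) :
    doubleLevel d c (u ++ v) x = doubleLevel d c u x := by
  induction u generalizing c with
  | nil => simp at h
  | cons y u ih =>
    by_cases hx : x = y
    · simp [doubleLevel, hx]
    · simp only [List.cons_append, doubleLevel, hx, if_false]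
      exact ih (by simpa [hx] using h)

theorem doubleLevel_append_right (h : x ∉ u) :
    doubleLevel d c (u ++ v) x = doubleLevel d (c + (u.map d).sum) v x := by
  induction u generalizing c with
  | nil => simp
  | cons y u ih =>
    simp only [List.mem_cons, not_or] at h
    simp only [List.cons_append, doubleLevel, h.1, if_false, List.map_cons, List.sum_cons]
    rw [ih h.2, add_assoc]

theorem doubleLevel_congr (h : ∀ y ∈ w, d y = d' y) :
    doubleLevel d c w x = doubleLevel d' c w x := by
  induction w generalizing c with
  | nil => rfl
  | cons y w ih =>
    simp only [List.mem_cons, forall_eq_or_imp] at h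
    simp only [doubleLevel, h.1, ih h.2]

theorem doubleLevel_map (f : Equiv.Perm ℕ) :
    doubleLevel d c (w.map (relabel f)) (x.relabel f)
      = doubleLevel (fun y => d (y.relabel f)) c w x := by
  induction w generalizing c with
  | nil => rfl
  | cons y w ih =>
    simp only [List.map_cons, doubleLevel, (relabel_injective f).eq_iff, ih]

/-- A block not containing `x` influences the level at `x` only through its total jump. -/
theorem doubleLevel_replace {s' : List GaussLetter} (h : x ∉ s) (h' : x ∉ s')
    (hd : (s.map d).sum = (s'.map d).sum) :
    doubleLevel d c (u ++ s ++ v) x = doubleLevel d c (u ++ s' ++ v) x := by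
  by_cases hx : x ∈ u
  · simp only [List.append_assoc, doubleLevel_append_left hx]
  · rw [doubleLevel_append_right (by simp [hx, h]), doubleLevel_append_right (by simp [hx, h'])]
    simp [hd]

theorem doubleLevel_block (h : x ∉ u) (hs : x ∈ s) :
    doubleLevel d c (u ++ s ++ v) x = doubleLevel d (c + (u.map d).sum) s x := by
  rw [List.append_assoc, doubleLevel_append_right h, doubleLevel_append_left hs]

theorem doubleLevel_zero_left (c : ℤ) (h : x ∈ w) : doubleLevel 0 c w x = 2 * c := by
  induction w generalizing c with
  | nil => simp at h
  | cons y w ih =>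
    by_cases hx : x = y
    · simp [doubleLevel, hx]
    · simp only [doubleLevel, hx, if_false]
      rw [ih _ (by simpa [hx] using h)]; simp

/-- Four times the intersection number of the cycles given by two level functions. -/
def pairing (d : GaussLetter → ℤ) (c : ℤ) (d' : GaussLetter → ℤ) (c' : ℤ)
    (w : List GaussLetter) : ℤ :=
  (w.map fun x => (x.side : ℤ) * doubleLevel d c w x * doubleLevel d' c' w x.other).sum

theorem pairing_congr {e e' : GaussLetter → ℤ} (h : ∀ y ∈ w, d y = e y)
    (h' : ∀ y ∈ w, d' y = e' y) : pairing d c d' c' w = pairing e c e' c' w := by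
  unfold pairing
  congr 2
  funext x
  rw [doubleLevel_congr h, doubleLevel_congr h']

/-- The passage `x` precedes the other passage through the same crossing. -/
def IsFirst (w : List GaussLetter) (x : GaussLetter) : Prop :=
  doubleLevel (Pi.single x 1) 0 w x.other = 2

instance : Decidable (IsFirst w x) := inferInstanceAs (Decidable (_ = _))

/-- For the first passage `x` through a crossing, twice the index of the crossing. -/
def doubleIndex (w : List GaussLetter) (x : GaussLetter) : ℤ :=
  doubleLevel (fun y => (y.side : ℤ)) 0 w x.other - doubleLevel (fun y => (y.side : ℤ)) 0 w x

/-- The weight of a crossing, determined by its type and index, at its first passage. -/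
def weight (φ : Bool → ℤ → ℤ) (w : List GaussLetter) (x : GaussLetter) : ℤ :=
  if IsFirst w x then x.sign * φ x.isOver (doubleIndex w x) else 0

/-- The jumps of the level function of the weighted sum of the loops at the crossings. -/
def jump (φ : Bool → ℤ → ℤ) (w : List GaussLetter) (x : GaussLetter) : ℤ :=
  weight φ w x - weight φ w x.other

/-- This is Kirchhoff's law at the crossing: the loops enter at one passage and leave at the other.
-/
theorem jump_other (φ : Bool → ℤ → ℤ) (w : List GaussLetter) (x : GaussLetter) :
    jump φ w x.other = -jump φ w x := by simp [jump]

/-- The pairing of two weighted sums of loops, shifted by multiples of the whole knot. -/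
def loopPairing (φ : Bool → ℤ → ℤ) (c : ℤ) (ψ : Bool → ℤ → ℤ) (c' : ℤ)
    (w : List GaussLetter) : ℤ :=
  pairing (jump φ w) c (jump ψ w) c' w

/-- A weight sees the word only through the order of the two passages and the index, so a move that
keeps both keeps all jumps. -/
theorem jump_eq_of (φ : Bool → ℤ → ℤ) {w w' : List GaussLetter}
    (ho : ∀ x ∈ w, x.other ∈ w)
    (hF : ∀ x ∈ w, doubleLevel (Pi.single x 1) 0 w x.other =
      doubleLevel (Pi.single x 1) 0 w' x.other)
    (hI : ∀ x ∈ w, doubleIndex w x = doubleIndex w' x) (x : GaussLetter) (hx : x ∈ w) :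
    jump φ w x = jump φ w' x := by
  have key : ∀ x ∈ w, weight φ w x = weight φ w' x := by
    intro x hx
    simp only [weight, IsFirst, hF x hx, hI x hx]
    congr
  rw [jump, jump, key x hx, key _ (ho x hx)]

theorem loopPairing_relabel (φ ψ : Bool → ℤ → ℤ) (f : Equiv.Perm ℕ) (w : List GaussLetter) :
    loopPairing φ c ψ c' (w.map (relabel f)) = loopPairing φ c ψ c' w := by
  have hw : ∀ (χ : Bool → ℤ → ℤ) x,
      weight χ (w.map (relabel f)) (x.relabel f) = weight χ w x := by
    intro χ x
    have h1 : IsFirst (w.map (relabel f)) (x.relabel f) ↔ IsFirst w x := by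
      simp only [IsFirst, relabel_other, doubleLevel_map]
      have : (fun y : GaussLetter => (Pi.single (x.relabel f) 1 : GaussLetter → ℤ) (y.relabel f))
          = Pi.single x 1 := by
        funext y
        by_cases h : y = x
        · simp [h]
        · rw [Pi.single_eq_of_ne h, Pi.single_eq_of_ne ((relabel_injective f).ne h)]
      rw [this]
    have h2 : doubleIndex (w.map (relabel f)) (x.relabel f) = doubleIndex w x := by
      simp only [doubleIndex, relabel_other, doubleLevel_map, relabel_side]
    simp only [weight, h1, h2]; rfl
  have hj : ∀ (χ : Bool → ℤ → ℤ),
      (fun x => jump χ (w.map (relabel f)) (x.relabel f)) = jump χ w := by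
    intro χ; funext x; simp only [jump, relabel_other, hw]
  simp only [loopPairing, pairing, List.map_map]
  congr 2
  funext x
  simp only [Function.comp, relabel_other, relabel_side, doubleLevel_map, hj]

theorem pairing_insert {w w' s : List GaussLetter} (hp : w'.Perm (w ++ s))
    (ho : ∀ x ∈ w, x.other ∈ w)
    (h : ∀ x ∈ w, doubleLevel d c w x = doubleLevel d c w' x)
    (h' : ∀ x ∈ w, doubleLevel d' c' w x = doubleLevel d' c' w' x)
    (hs : (s.map fun x =>
      (x.side : ℤ) * doubleLevel d c w' x * doubleLevel d' c' w' x.other).sum = 0) :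
    pairing d c d' c' w = pairing d c d' c' w' := by
  unfold pairing
  rw [(hp.map _).sum_eq, List.map_append, List.sum_append, hs, add_zero]
  congr 1
  refine List.map_congr_left fun x hx => ?_
  rw [h x hx, h' _ (ho x hx)]

end GaussWord

/-! ### Invariance under the first and second Reidemeister moves -/

namespace GaussWord

open GaussLetter

variable {d d' : GaussLetter → ℤ} {c c' : ℤ} {u v w s : List GaussLetter} {x y : GaussLetter}

theorem single_sum_eq_zero (h : x ∉ s) :
    (s.map (Pi.single x 1 : GaussLetter → ℤ)).sum = 0 := by
  apply List.sum_eq_zero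
  intro z hz
  obtain ⟨y, hy, rfl⟩ := List.mem_map.1 hz
  exact Pi.single_eq_of_ne (by rintro rfl; exact h hy) _

/-- Insertion of letters preserves the pairing of weighted sums of loops if level functions
are not affected and the new crossings contribute nothing. -/
theorem loopPairing_insert (φ ψ : Bool → ℤ → ℤ) {w w' s : List GaussLetter}
    (hp : w'.Perm (w ++ s)) (ho : ∀ x ∈ w, x.other ∈ w)
    (hside : ∀ x ∈ w, doubleLevel (fun y => (y.side : ℤ)) 0 w x =
      doubleLevel (fun y => (y.side : ℤ)) 0 w' x)
    (hsingle : ∀ y ∈ w, ∀ x ∈ w, doubleLevel (Pi.single y 1) 0 w x =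
      doubleLevel (Pi.single y 1) 0 w' x)
    (hjump : ∀ χ, ∀ c, ∀ x ∈ w,
      doubleLevel (jump χ w') c w x = doubleLevel (jump χ w') c w' x)
    (hs : (s.map fun x => (x.side : ℤ) * doubleLevel (jump φ w') c w' x *
      doubleLevel (jump ψ w') c' w' x.other).sum = 0) :
    loopPairing φ c ψ c' w = loopPairing φ c ψ c' w' := by
  have hj : ∀ χ, ∀ x ∈ w, jump χ w x = jump χ w' x := fun χ =>
    jump_eq_of χ ho (fun x hx => hsingle x hx _ (ho x hx))
      fun x hx => by rw [doubleIndex, doubleIndex, hside x hx, hside _ (ho x hx)]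
  rw [loopPairing, pairing_congr (hj φ) (hj ψ)]
  exact pairing_insert hp ho (hjump φ c) (hjump ψ c') hs

/-- The loop of the kink may have nonzero weight, but its jumps cancel before any other passage is
met. The two new passages have equal levels and opposite sides, so their terms in the pairing
cancel. -/
theorem loopPairing_reidemeister1 (φ ψ : Bool → ℤ → ℤ) (u v : List GaussLetter) (x : GaussLetter)
    (hn : (u ++ [x, x.other] ++ v).Nodup) (ho : ∀ y ∈ u ++ v, y.other ∈ u ++ v) :
    loopPairing φ c ψ c' (u ++ v) = loopPairing φ c ψ c' (u ++ [x, x.other] ++ v) := by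
  have hx : ∀ y ∈ u ++ v, y ∉ [x, x.other] := by
    intro y hy hy'
    rw [List.nodup_append, List.nodup_append] at hn
    rcases List.mem_append.1 hy with h | h
    · exact hn.1.2.2 y h y hy' rfl
    · exact hn.2.2 y (List.mem_append_right _ hy') y h rfl
  have hxu : x ∉ u := fun h => hx x (List.mem_append_left _ h) (by simp)
  have hxu' : x.other ∉ u := fun h => hx x.other (List.mem_append_left _ h) (by simp)
  have key : ∀ (d : GaussLetter → ℤ) c, d x + d x.other = 0 → ∀ y ∈ u ++ v,
      doubleLevel d c (u ++ v) y = doubleLevel d c (u ++ [x, x.other] ++ v) y := by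
    intro d c hd y hy
    have := doubleLevel_replace (d := d) (c := c) (u := u) (v := v) (s := [])
      (s' := [x, x.other]) (x := y) (by simp) (hx y hy) (by simp [hd])
    simpa using this
  refine loopPairing_insert φ ψ (s := [x, x.other]) ?_ ho (key _ _ ?_)
    (fun y hy => key _ _ ?_) (fun χ c => key _ _ ?_) ?_
  · rw [List.perm_iff_count]; intro a; simp only [List.count_append]; omega
  · simp [side_other]
  · simpa using single_sum_eq_zero (hx y hy)
  · simp [jump_other]
  · simp only [List.map_cons, List.map_nil, List.sum_cons, List.sum_nil, other_other]
    have h1 : ∀ d : GaussLetter → ℤ, ∀ c, d x.other = -d x →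
        doubleLevel d c (u ++ [x, x.other] ++ v) x.other =
        doubleLevel d c (u ++ [x, x.other] ++ v) x := by
      intro d c hd
      rw [doubleLevel_block hxu (by simp), doubleLevel_block hxu' (by simp)]
      simp [doubleLevel, other_ne, hd]
      ring
    rw [h1 _ _ (jump_other _ _ _), h1 _ _ (jump_other _ _ _), side_other]
    simp

/-- The two new crossings have the same type, index and order of passages but opposite signs, so
their jumps cancel on each strand. Both then lie at the same levels with opposite sides, and their
terms cancel as well. -/
theorem loopPairing_reidemeister2 (φ ψ : Bool → ℤ → ℤ) (u₀ u₁ u₂ q : List GaussLetter)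
    (x y : GaussLetter) (hq : q = [x.other, y.other] ∨ q = [y.other, x.other])
    (hs : y.sign = -x.sign) (hxy : y.isOver = x.isOver)
    (hn : (u₀ ++ [x, y] ++ u₁ ++ q ++ u₂).Nodup)
    (ho : ∀ y ∈ u₀ ++ u₁ ++ u₂, y.other ∈ u₀ ++ u₁ ++ u₂) :
    loopPairing φ c ψ c' (u₀ ++ u₁ ++ u₂) =
      loopPairing φ c ψ c' (u₀ ++ [x, y] ++ u₁ ++ q ++ u₂) := by
  have hside : y.side = -x.side := by simp [side, hs, hxy]; split_ifs <;> simp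
  have hqp : q.Perm [x.other, y.other] := by
    rcases hq with rfl | rfl
    · rfl
    · exact List.Perm.swap _ _ _
  have hqm : ∀ z, z ∈ q ↔ z ∈ [x.other, y.other] := fun z => hqp.mem_iff
  set w' := u₀ ++ [x, y] ++ u₁ ++ q ++ u₂ with hw'
  have hp : w'.Perm ((u₀ ++ u₁ ++ u₂) ++ ([x, y] ++ [x.other, y.other])) := by
    rw [List.perm_iff_count]; intro a
    simp only [hw', List.count_append, hqp.count_eq]; omega
  have hn' := hp.nodup_iff.1 hn
  rw [List.nodup_append] at hn'
  obtain ⟨-, hn4, hdis⟩ := hn'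
  have hout : ∀ z ∈ u₀ ++ u₁ ++ u₂, z ∉ [x, y] ∧ z ∉ q := by
    intro z hz
    refine ⟨fun h => hdis z hz z (List.mem_append_left _ h) rfl, fun h => ?_⟩
    exact hdis z hz z (List.mem_append_right _ ((hqm z).1 h)) rfl
  have hne : x ≠ y ∧ x ≠ x.other ∧ x ≠ y.other ∧ y ≠ x.other ∧ y ≠ y.other ∧
      x.other ≠ y.other := by
    simp at hn4; tauto
  have hu0 : ∀ z ∈ [x, y] ++ [x.other, y.other], z ∉ u₀ ∧ z ∉ u₁ := fun z hz =>
    ⟨fun h => hdis z (by simp [h]) z hz rfl, fun h => hdis z (by simp [h]) z hz rfl⟩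
  -- level functions which do not see the bigon
  have key : ∀ (d : GaussLetter → ℤ) c, d x + d y = 0 → d x.other + d y.other = 0 →
      ∀ z ∈ u₀ ++ u₁ ++ u₂, doubleLevel d c (u₀ ++ u₁ ++ u₂) z = doubleLevel d c w' z := by
    intro d c hd hd' z hz
    have e1 := doubleLevel_replace (d := d) (c := c) (u := u₀) (v := u₁ ++ u₂) (s := [])
      (s' := [x, y]) (x := z) (by simp) (hout z hz).1 (by simp [hd])
    have e2 := doubleLevel_replace (d := d) (c := c) (u := u₀ ++ [x, y] ++ u₁) (v := u₂)
      (s := []) (s' := q) (x := z) (by simp) (hout z hz).2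
      (by rw [(hqp.map d).sum_eq]; simp [hd'])
    simp only [List.append_nil] at e1 e2
    rw [List.append_assoc, e1, hw', ← e2]
    simp
  have hP : ∀ (d : GaussLetter → ℤ) c, d x + d y = 0 →
      doubleLevel d c w' y = doubleLevel d c w' x := by
    intro d c hd
    have e : w' = u₀ ++ [x, y] ++ (u₁ ++ q ++ u₂) := by simp [hw']
    rw [e, doubleLevel_block (hu0 x (by simp)).1 (by simp),
      doubleLevel_block (hu0 y (by simp)).1 (by simp)]
    simp [doubleLevel, hne.1.symm]; omega
  have hQ : ∀ (d : GaussLetter → ℤ) c, d x.other + d y.other = 0 →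
      doubleLevel d c w' y.other = doubleLevel d c w' x.other := by
    intro d c hd
    have hB : x.other ∉ u₀ ++ [x, y] ++ u₁ ∧ y.other ∉ u₀ ++ [x, y] ++ u₁ := by
      simp [hu0 x.other (by simp), hu0 y.other (by simp), hne.2.2.1.symm, hne.2.2.2.1.symm,
        other_ne]
    rw [hw', doubleLevel_block hB.1 (by simp [hqm]), doubleLevel_block hB.2 (by simp [hqm])]
    rcases hq with rfl | rfl
    · simp [doubleLevel, hne.2.2.2.2.2.symm]; omega
    · simp [doubleLevel, hne.2.2.2.2.2]; omega
  have hsingle : ∀ a b : GaussLetter, a ∈ [x, y] → b ∈ [x.other, y.other] →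
      doubleLevel (Pi.single a 1) 0 w' b = 2 ∧ doubleLevel (Pi.single b 1) 0 w' a = 0 := by
    intro a b ha hb
    have hab : a ≠ b := by
      simp only [List.mem_cons, List.not_mem_nil, or_false] at ha hb
      rcases ha with rfl | rfl <;> rcases hb with rfl | rfl <;> tauto
    have hbp : b ∉ [x, y] := by
      simp only [List.mem_cons, List.not_mem_nil, or_false] at hb ⊢
      rcases hb with rfl | rfl <;> simp [hne.2.2.1.symm, hne.2.2.2.1.symm, other_ne]
    have ha' := hu0 a (by simp at ha ⊢; tauto)
    have hb' := hu0 b (by simp at hb ⊢; tauto)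
    have haq : a ∉ q := by
      rw [hqm]; simp only [List.mem_cons, List.not_mem_nil, or_false] at ha ⊢
      rcases ha with rfl | rfl <;> tauto
    constructor
    -- Before the second block exactly one unit jump, at `a`, has occurred, and none occurs inside
    -- it: the doubled level there is 2, the value that defines `IsFirst`.
    · rw [hw', doubleLevel_block (by simp at hbp ⊢; tauto) ((hqm b).2 hb)]
      have h1 : (([x, y] : List GaussLetter).map (Pi.single a 1 : GaussLetter → ℤ)).sum = 1 := by
        simp only [List.mem_cons, List.not_mem_nil, or_false] at ha
        rcases ha with rfl | rfl
        · simp [Pi.single_eq_of_ne hne.1.symm]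
        · simp [Pi.single_eq_of_ne hne.1]
      rw [doubleLevel_congr (d' := 0), doubleLevel_zero_left _ ((hqm b).2 hb)]
      · simp only [List.map_append, List.sum_append, h1, single_sum_eq_zero ha'.1,
          single_sum_eq_zero ha'.2]; norm_num
      · intro z hz; exact Pi.single_eq_of_ne (by rintro rfl; exact haq hz) _
    · have e : w' = u₀ ++ [x, y] ++ (u₁ ++ q ++ u₂) := by simp [hw']
      rw [e, doubleLevel_block ha'.1 ha, doubleLevel_congr (d' := 0),
        doubleLevel_zero_left _ ha, single_sum_eq_zero hb'.1]
      · norm_num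
      · intro z hz; exact Pi.single_eq_of_ne (by rintro rfl; exact hbp hz) _
  have hjump : ∀ χ, jump χ w' x + jump χ w' y = 0 := by
    intro χ
    have s1 := hP (fun y => (y.side : ℤ)) 0 (by simp [hside])
    have s2 := hQ (fun y => (y.side : ℤ)) 0 (by simp [hside, side_other])
    have f1 := (hsingle x x.other (by simp) (by simp))
    have f2 := (hsingle y y.other (by simp) (by simp))
    simp only [jump, weight, IsFirst, other_other, f1.1, f1.2, f2.1, f2.2, doubleIndex, s1, s2,
      hxy, hs]
    norm_num
  have hjump' : ∀ χ, jump χ w' x.other + jump χ w' y.other = 0 := by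
    intro χ; rw [jump_other, jump_other]; linarith [hjump χ]
  refine loopPairing_insert φ ψ hp ho (key _ _ (by simp [hside])
    (by simp [hside, side_other])) (fun z hz => key _ _ ?_ ?_)
    (fun χ c => key _ _ (hjump χ) (hjump' χ)) ?_
  · simpa using single_sum_eq_zero (hout z hz).1
  · have := single_sum_eq_zero (hout z hz).2
    rw [(hqp.map _).sum_eq] at this
    simpa using this
  · simp [hP _ _ (hjump _), hQ _ _ (hjump' _), hside, side_other]

end GaussWord

/-! ### Invariance under the third Reidemeister move -/

namespace GaussWord

open GaussLetter

variable {d d' : GaussLetter → ℤ} {c c' : ℤ} {u v w s : List GaussLetter} {x y : GaussLetter}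

/-- Both orders deviate from the common mean `2 * c + d x + d y` by the same amount with opposite
signs. Recording the order in the sign `p` makes the third move a polynomial computation. -/
theorem doubleLevel_orderedPair (d : GaussLetter → ℤ) (c : ℤ) (p : ℤˣ) (h : x ≠ y) :
    doubleLevel d c (orderedPair p x y) x = (2 * c + d x + d y) - p * d y ∧
    doubleLevel d c (orderedPair p x y).reverse x = (2 * c + d x + d y) + p * d y ∧
    doubleLevel d c (orderedPair p x y) y = (2 * c + d x + d y) + p * d x ∧
    doubleLevel d c (orderedPair p x y).reverse y = (2 * c + d x + d y) - p * d x := by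
  have h' := h.symm
  rcases Int.units_eq_one_or p with rfl | rfl
  · simp [orderedPair, doubleLevel, h, h']; ring_nf; simp
  · have : (-1 : ℤˣ) ≠ 1 := by decide
    simp [orderedPair, doubleLevel, h, h', this]; ring_nf; simp

theorem mem_orderedPair (p : ℤˣ) (z : GaussLetter) :
    z ∈ orderedPair p x y ↔ z = x ∨ z = y := by
  unfold orderedPair; split_ifs <;> simp [or_comm]

theorem orderedPair_perm (p : ℤˣ) : (orderedPair p x y).Perm [x, y] := by
  unfold orderedPair; split_ifs
  · rfl
  · exact List.Perm.swap _ _ _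

/-- The level functions on two strands passing through each other in different orders. -/
structure Swapped (w w' : List GaussLetter) (p : ℤˣ) (x y : GaussLetter) : Prop where
  levels : ∀ d c, ∃ t, doubleLevel d c w x = t - p * d y ∧ doubleLevel d c w' x = t + p * d y ∧
    doubleLevel d c w y = t + p * d x ∧ doubleLevel d c w' y = t - p * d x

/-- Reversing the earlier blocks keeps their total jumps, so the mean level on the strand is the
same in both words. -/
theorem swapped_of_blocks {u₀ u₁ u₂ u₃ s₁ s₂ s₃ : List GaussLetter}
    (hn : (u₀ ++ s₁ ++ u₁ ++ s₂ ++ u₂ ++ s₃ ++ u₃).Nodup) (p : ℤˣ) (hxy : x ≠ y)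
    (h : orderedPair p x y ∈ [s₁, s₂, s₃]) :
    Swapped (u₀ ++ s₁ ++ u₁ ++ s₂ ++ u₂ ++ s₃ ++ u₃)
      (u₀ ++ s₁.reverse ++ u₁ ++ s₂.reverse ++ u₂ ++ s₃.reverse ++ u₃) p x y := by
  have main : ∀ u u' v v' : List GaussLetter,
      (∀ d : GaussLetter → ℤ, (u.map d).sum = (u'.map d).sum) →
      x ∉ u → y ∉ u → x ∉ u' → y ∉ u' →
      Swapped (u ++ orderedPair p x y ++ v) (u' ++ (orderedPair p x y).reverse ++ v') p x y := by
    intro u u' v v' hd h1 h2 h3 h4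
    refine ⟨fun d c => ⟨2 * (c + (u.map d).sum) + d x + d y, ?_⟩⟩
    have hx : x ∈ orderedPair p x y := (mem_orderedPair p x).2 (Or.inl rfl)
    have hy : y ∈ orderedPair p x y := (mem_orderedPair p y).2 (Or.inr rfl)
    rw [doubleLevel_block h1 hx, doubleLevel_block h2 hy, doubleLevel_block h3 (by simpa),
      doubleLevel_block h4 (by simpa), ← hd]
    exact doubleLevel_orderedPair d _ p hxy
  have hmem : ∀ u v : List GaussLetter, (u ++ orderedPair p x y ++ v).Nodup → x ∉ u ∧ y ∉ u := by
    intro u v hn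
    rw [List.nodup_append, List.nodup_append] at hn
    exact ⟨fun h => hn.1.2.2 x h x ((mem_orderedPair p x).2 (Or.inl rfl)) rfl,
      fun h => hn.1.2.2 y h y ((mem_orderedPair p y).2 (Or.inr rfl)) rfl⟩
  simp only [List.mem_cons, List.not_mem_nil, or_false] at h
  rcases h with rfl | rfl | rfl
  · have e := hmem u₀ (u₁ ++ s₂ ++ u₂ ++ s₃ ++ u₃) (by simpa using hn)
    have := main u₀ u₀ (u₁ ++ s₂ ++ u₂ ++ s₃ ++ u₃) (u₁ ++ s₂.reverse ++ u₂ ++ s₃.reverse ++ u₃)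
      (fun _ => rfl) e.1 e.2 e.1 e.2
    simpa using this
  · have e := hmem (u₀ ++ s₁ ++ u₁) (u₂ ++ s₃ ++ u₃) (by simpa using hn)
    have := main (u₀ ++ s₁ ++ u₁) (u₀ ++ s₁.reverse ++ u₁) (u₂ ++ s₃ ++ u₃)
      (u₂ ++ s₃.reverse ++ u₃) (fun d => by simp [List.sum_reverse]) e.1 e.2
      (by simpa using e.1) (by simpa using e.2)
    simpa using this
  · have e := hmem (u₀ ++ s₁ ++ u₁ ++ s₂ ++ u₂) u₃ (by simpa using hn)
    have := main (u₀ ++ s₁ ++ u₁ ++ s₂ ++ u₂) (u₀ ++ s₁.reverse ++ u₁ ++ s₂.reverse ++ u₂) u₃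
      u₃ (fun d => by simp [List.sum_reverse]) e.1 e.2
      (by simpa using e.1) (by simpa using e.2)
    simpa using this

theorem doubleLevel_reverse_blocks {u₀ u₁ u₂ u₃ s₁ s₂ s₃ : List GaussLetter}
    (h₁ : x ∉ s₁) (h₂ : x ∉ s₂) (h₃ : x ∉ s₃) :
    doubleLevel d c (u₀ ++ s₁ ++ u₁ ++ s₂ ++ u₂ ++ s₃ ++ u₃) x =
      doubleLevel d c (u₀ ++ s₁.reverse ++ u₁ ++ s₂.reverse ++ u₂ ++ s₃.reverse ++ u₃) x := by
  have hr : ∀ s : List GaussLetter, (s.map d).sum = (s.reverse.map d).sum := fun s => by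
    simp [List.sum_reverse]
  have e1 := doubleLevel_replace (d := d) (c := c) (u := u₀)
    (v := u₁ ++ s₂ ++ u₂ ++ s₃ ++ u₃) h₁ (by simpa using h₁) (hr s₁)
  have e2 := doubleLevel_replace (d := d) (c := c) (u := u₀ ++ s₁.reverse ++ u₁)
    (v := u₂ ++ s₃ ++ u₃) h₂ (by simpa using h₂) (hr s₂)
  have e3 := doubleLevel_replace (d := d) (c := c) (u := u₀ ++ s₁.reverse ++ u₁ ++ s₂.reverse ++ u₂)
    (v := u₃) h₃ (by simpa using h₃) (hr s₃)
  simp only [List.append_assoc] at e1 e2 e3 ⊢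
  rw [e1, e2, e3]

/-- For the jumps `side`, the deviations from the mean at the two passages of a crossing are equal,
because squares of signs are 1. They drop out of the index, which is a difference of levels. -/
theorem doubleIndex_swapped {w w' : List GaussLetter} {x y z l : GaussLetter} {p : ℤˣ}
    (top : Swapped w w' (p * y.side) x y) (mid : Swapped w w' (p * z.side) x.other z)
    (bot : Swapped w w' (p * x.side * y.side * z.side) y.other z.other)
    (h : l ∈ [x, y, x.other, z, y.other, z.other]) : doubleIndex w l = doubleIndex w' l := by
  have sq : ∀ l : GaussLetter, (l.side : ℤ) * l.side = 1 := fun l => by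
    rw [← Units.val_mul, Int.units_mul_self]; rfl
  obtain ⟨t, t1, t2, t3, t4⟩ := top.levels (fun y => (y.side : ℤ)) 0
  obtain ⟨m, m1, m2, m3, m4⟩ := mid.levels (fun y => (y.side : ℤ)) 0
  obtain ⟨b, b1, b2, b3, b4⟩ := bot.levels (fun y => (y.side : ℤ)) 0
  simp only [side_other] at t1 t2 t3 t4 m1 m2 m3 m4 b1 b2 b3 b4
  simp only [List.mem_cons, List.not_mem_nil, or_false] at h
  rcases h with h | h | h | h | h | h <;> rw [h] <;>
    simp only [doubleIndex, other_other, t1, t2, t3, t4, m1, m2, m3, m4, b1, b2, b3, b4] <;>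
    push_cast
  · linear_combination (-2 * (p : ℤ)) * sq z + 2 * p * sq y
  · linear_combination (2 * (p : ℤ) * x.side * y.side) * sq z
  · linear_combination (2 * (p : ℤ)) * sq z - 2 * p * sq y
  · linear_combination (-2 * (p : ℤ) * x.side * z.side) * sq y
  · linear_combination (-2 * (p : ℤ) * x.side * y.side) * sq z
  · linear_combination (2 * (p : ℤ) * x.side * z.side) * sq y

/-- The move replaces `p` by `-p`, so only terms odd in `p` matter. Each of them is the mean level
of one strand times the jump at the crossing of the other two strands. It arises at both crossings
on the first strand, with opposite signs: this is where the orders prescribed by the signs of the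
triangle are needed. -/
theorem sum_triangle_swapped {w w' : List GaussLetter} {x y z : GaussLetter} {p : ℤˣ}
    (top : Swapped w w' (p * y.side) x y) (mid : Swapped w w' (p * z.side) x.other z)
    (bot : Swapped w w' (p * x.side * y.side * z.side) y.other z.other)
    (dO : ∀ l, d l.other = -d l) (dO' : ∀ l, d' l.other = -d' l) :
    ([x, y, x.other, z, y.other, z.other].map fun l =>
      (l.side : ℤ) * doubleLevel d c w l * doubleLevel d' c' w l.other).sum =
    ([x, y, x.other, z, y.other, z.other].map fun l =>
      (l.side : ℤ) * doubleLevel d c w' l * doubleLevel d' c' w' l.other).sum := by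
  obtain ⟨t, t1, t2, t3, t4⟩ := top.levels d c
  obtain ⟨m, m1, m2, m3, m4⟩ := mid.levels d c
  obtain ⟨b, b1, b2, b3, b4⟩ := bot.levels d c
  obtain ⟨t', t1', t2', t3', t4'⟩ := top.levels d' c'
  obtain ⟨m', m1', m2', m3', m4'⟩ := mid.levels d' c'
  obtain ⟨b', b1', b2', b3', b4'⟩ := bot.levels d' c'
  simp only [List.map_cons, List.map_nil, List.sum_cons, List.sum_nil, other_other, side_other,
    t1, t2, t3, t4, m1, m2, m3, m4, b1, b2, b3, b4,
    t1', t2', t3', t4', m1', m2', m3', m4', b1', b2', b3', b4', dO, dO']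
  have hx : (x.side : ℤ) = 1 ∨ (x.side : ℤ) = -1 := by
    rcases Int.units_eq_one_or x.side with h | h <;> simp [h]
  have hy : (y.side : ℤ) = 1 ∨ (y.side : ℤ) = -1 := by
    rcases Int.units_eq_one_or y.side with h | h <;> simp [h]
  have hz : (z.side : ℤ) = 1 ∨ (z.side : ℤ) = -1 := by
    rcases Int.units_eq_one_or z.side with h | h <;> simp [h]
  clear * - hx hy hz
  push_cast
  generalize (x.side : ℤ) = X at *
  generalize (y.side : ℤ) = Y at *
  generalize (z.side : ℤ) = Z at *
  rcases hx with rfl | rfl <;> rcases hy with rfl | rfl <;> rcases hz with rfl | rfl <;> ring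

theorem loopPairing_reidemeister3 (φ ψ : Bool → ℤ → ℤ)
    (u₀ u₁ u₂ u₃ s₁ s₂ s₃ : List GaussLetter) (x y z : GaussLetter) (p : ℤˣ)
    (hs : List.Perm [s₁, s₂, s₃] [orderedPair (p * y.side) x y, orderedPair (p * z.side) x.other z,
      orderedPair (p * x.side * y.side * z.side) y.other z.other])
    (hn : (u₀ ++ s₁ ++ u₁ ++ s₂ ++ u₂ ++ s₃ ++ u₃).Nodup)
    (ho : ∀ l ∈ u₀ ++ s₁ ++ u₁ ++ s₂ ++ u₂ ++ s₃ ++ u₃,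
      l.other ∈ u₀ ++ s₁ ++ u₁ ++ s₂ ++ u₂ ++ s₃ ++ u₃) :
    loopPairing φ c ψ c' (u₀ ++ s₁ ++ u₁ ++ s₂ ++ u₂ ++ s₃ ++ u₃) = loopPairing φ c ψ c'
      (u₀ ++ s₁.reverse ++ u₁ ++ s₂.reverse ++ u₂ ++ s₃.reverse ++ u₃) := by
  set w := u₀ ++ s₁ ++ u₁ ++ s₂ ++ u₂ ++ s₃ ++ u₃ with hw
  set w' := u₀ ++ s₁.reverse ++ u₁ ++ s₂.reverse ++ u₂ ++ s₃.reverse ++ u₃ with hw'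
  have hblocks : (s₁ ++ s₂ ++ s₃).Perm [x, y, x.other, z, y.other, z.other] := by
    have h := hs.flatten
    simp only [List.flatten_cons, List.flatten_nil, List.append_nil] at h
    refine (by simpa using h : (s₁ ++ s₂ ++ s₃).Perm _).trans ?_
    exact (orderedPair_perm _).append ((orderedPair_perm _).append (orderedPair_perm _))
  have hp : w.Perm (u₀ ++ u₁ ++ u₂ ++ u₃ ++ [x, y, x.other, z, y.other, z.other]) := by
    rw [List.perm_iff_count]; intro a
    have := hblocks.count_eq a
    simp only [hw, List.count_append] at this ⊢
    omega
  have hpp : w'.Perm w := by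
    rw [List.perm_iff_count]; intro a
    simp only [hw, hw', List.count_append, List.count_reverse]
  have hnd := hp.nodup_iff.1 hn
  rw [List.nodup_append] at hnd
  obtain ⟨-, hn6, hdis⟩ := hnd
  have hne : x ≠ y ∧ x.other ≠ z ∧ y.other ≠ z.other := by
    simp at hn6; tauto
  have hsw : ∀ q a b, a ≠ b → orderedPair q a b ∈ [orderedPair (p * y.side) x y,
      orderedPair (p * z.side) x.other z,
      orderedPair (p * x.side * y.side * z.side) y.other z.other] → Swapped w w' q a b :=
    fun q a b hab h => swapped_of_blocks hn q hab (hs.mem_iff.2 h)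
  have top := (hsw (p * y.side) x y hne.1 (by simp))
  have mid := (hsw (p * z.side) x.other z hne.2.1 (by simp))
  have bot := (hsw (p * x.side * y.side * z.side) y.other z.other hne.2.2 (by simp))
  clear hsw
  have hout : ∀ l ∈ w, l ∈ [x, y, x.other, z, y.other, z.other] ∨
      (l ∈ u₀ ++ u₁ ++ u₂ ++ u₃ ∧ ∀ d c, doubleLevel d c w l = doubleLevel d c w' l) := by
    intro l hl
    by_cases h : l ∈ [x, y, x.other, z, y.other, z.other]
    · exact Or.inl h
    · refine Or.inr ⟨?_, fun d c => ?_⟩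
      · rcases List.mem_append.1 (hp.mem_iff.1 hl) with h' | h'
        · exact h'
        · exact absurd h' h
      · have h' := fun hh => h (hblocks.mem_iff.1 hh)
        simp only [List.mem_append] at h'
        exact doubleLevel_reverse_blocks (fun e => h' (.inl (.inl e)))
          (fun e => h' (.inl (.inr e))) (fun e => h' (.inr e))
  have hother : ∀ l ∈ u₀ ++ u₁ ++ u₂ ++ u₃, l.other ∈ w ∧
      l.other ∉ [x, y, x.other, z, y.other, z.other] := by
    intro l hl
    refine ⟨ho l (hp.mem_iff.2 (List.mem_append_left _ hl)), fun h => ?_⟩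
    refine hdis l hl l ?_ rfl
    simp only [List.mem_cons, List.not_mem_nil, or_false] at h ⊢
    have e : l = l.other.other := (other_other l).symm
    rcases h with h | h | h | h | h | h <;> rw [e, h] <;> simp
  -- The two passages of a crossing lie on different strands, so their order survives: the unit jump
  -- at `l` is not at the neighbour with which `l.other` is exchanged.
  have hF : ∀ l ∈ w, doubleLevel (Pi.single l 1) 0 w l.other =
      doubleLevel (Pi.single l 1) 0 w' l.other := by
    intro l hl
    rcases hout _ (ho l hl) with h | h
    · have e : ∀ a, l.other = a → l = a.other := by rintro a rfl; simp
      have sz : ∀ a b : GaussLetter, b ≠ a → (Pi.single a (1 : ℤ) : GaussLetter → ℤ) b = 0 :=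
        fun a b h => Pi.single_eq_of_ne h _
      simp only [List.nodup_cons, List.mem_cons, List.not_mem_nil, not_or, or_false] at h hn6
      obtain ⟨t, t1, t2, t3, t4⟩ := top.levels (Pi.single l 1) 0
      obtain ⟨m, m1, m2, m3, m4⟩ := mid.levels (Pi.single l 1) 0
      obtain ⟨b, b1, b2, b3, b4⟩ := bot.levels (Pi.single l 1) 0
      rcases h with h | h | h | h | h | h <;> rw [h] <;> have h' := e _ h
      · rw [t1, t2, sz _ _ (by rw [h']; tauto)]; simp
      · rw [t3, t4, sz _ _ (by rw [h']; tauto)]; simp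
      · rw [m1, m2, sz _ _ (by rw [h', other_other]; tauto)]; simp
      · rw [m3, m4, sz _ _ (by rw [h']; tauto)]; simp
      · rw [b1, b2, sz _ _ (by rw [h', other_other]; tauto)]; simp
      · rw [b3, b4, sz _ _ (by rw [h', other_other]; tauto)]; simp
    · exact h.2 _ _
  have hI : ∀ l ∈ w, doubleIndex w l = doubleIndex w' l := by
    intro l hl
    rcases hout _ hl with h | h
    · exact doubleIndex_swapped top mid bot h
    · have h2 := (hother l h.1)
      rcases hout _ h2.1 with h' | h'
      · exact absurd h' h2.2
      · rw [doubleIndex, doubleIndex, h.2, h'.2]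
  have hj : ∀ χ, ∀ l ∈ w, jump χ w l = jump χ w' l := fun χ => jump_eq_of χ ho hF hI
  rw [loopPairing, pairing_congr (hj φ) (hj ψ), loopPairing]
  generalize hdd : jump φ w' = d
  generalize hdd' : jump ψ w' = d'
  have dO : ∀ l, d l.other = - d l := fun l => by rw [← hdd, jump_other]
  have dO' : ∀ l, d' l.other = - d' l := fun l => by rw [← hdd', jump_other]
  unfold pairing
  rw [(hpp.map _).sum_eq, (hp.map _).sum_eq, (hp.map _).sum_eq]
  simp only [List.map_append (l₂ := [x, y, x.other, z, y.other, z.other]),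
    List.sum_append (l₂ := List.map _ [x, y, x.other, z, y.other, z.other])]
  congr 1
  · congr 1
    refine List.map_congr_left fun l hl => ?_
    have h1 := hout l (hp.mem_iff.2 (List.mem_append_left _ hl))
    have h2 := hother l hl
    have h3 := hout _ h2.1
    rcases h1 with h1 | h1
    · exact absurd rfl (hdis l hl l h1)
    · rcases h3 with h3 | h3
      · exact absurd h3 h2.2
      · rw [h1.2, h3.2]
  · exact sum_triangle_swapped top mid bot dO dO'

theorem loopPairing_eq_of_gaussMove (φ ψ : Bool → ℤ → ℤ) (c c' : ℤ) (D D' : LongGaussDiagram)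
    (h : GaussMove D.word D'.word) :
    loopPairing φ c ψ c' D.word = loopPairing φ c ψ c' D'.word := by
  have hn := D.nodup
  have hn' := D'.nodup
  have ho := D.other_mem
  generalize D.word = w at *
  generalize D'.word = w' at *
  cases h with
  | relabel f w => rw [loopPairing_relabel]
  | reidemeister1 u₀ u₁ a e o => exact loopPairing_reidemeister1 φ ψ u₀ u₁ ⟨a, o, e⟩ hn' ho
  | reidemeister2 u₀ u₁ u₂ p q a b e o hp hq =>
    subst hp
    exact loopPairing_reidemeister2 φ ψ u₀ u₁ u₂ q ⟨a, o, e⟩ ⟨b, o, -e⟩ hq rfl rfl hn' ho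
  | reidemeister3 u₀ u₁ u₂ u₃ s₁ s₂ s₃ a b c ea eb ec d hs =>
    exact loopPairing_reidemeister3 φ ψ u₀ u₁ u₂ u₃ s₁ s₂ s₃ ⟨a, true, ea⟩ ⟨b, true, eb⟩
      ⟨c, true, ec⟩ d hs hn ho

end GaussWord

/-- The invariant of long virtual knots given by the pairing of weighted sums of loops. -/
def LongVirtualKnot.loopPairing (φ : Bool → ℤ → ℤ) (c : ℤ) (ψ : Bool → ℤ → ℤ) (c' : ℤ)
    (K : LongVirtualKnot) : ℤ :=
  Quot.lift (fun D : LongGaussDiagram => GaussWord.loopPairing φ c ψ c' D.word)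
    (GaussWord.loopPairing_eq_of_gaussMove φ ψ c c') K

/-! ### Flows, boundary circles and the rank inequality -/

namespace LongGaussDiagram

open GaussLetter GaussWord

variable (D : LongGaussDiagram)

theorem exists_other (i : Fin D.word.length) :
    ∃ j, D.word.get j = (D.word.get i).other :=
  List.get_of_mem (D.other_mem _ (List.get_mem _ _))

theorem get_injective : Function.Injective D.word.get := List.nodup_iff_injective_get.1 D.nodup

/-- The other passage through the crossing of a given passage. -/
noncomputable def opp : Equiv.Perm (Fin D.word.length) :=
  Function.Involutive.toPerm (fun i => (D.exists_other i).choose) fun i => by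
    apply D.get_injective
    rw [(D.exists_other _).choose_spec, (D.exists_other i).choose_spec, other_other]

theorem get_opp (i : Fin D.word.length) : D.word.get (D.opp i) = (D.word.get i).other :=
  (D.exists_other i).choose_spec

theorem opp_opp (i : Fin D.word.length) : D.opp (D.opp i) = i :=
  D.get_injective (by rw [get_opp, get_opp, other_other])

/-- Kirchhoff's law at each crossing. -/
def IsFlow (X : Fin (D.word.length + 1) → ℤ) : Prop :=
  ∀ i, X (D.opp i).succ - X (D.opp i).castSucc = -(X i.succ - X i.castSucc)

/-- Four times the intersection number of two flows. -/
noncomputable def flowPairing (X Y : Fin (D.word.length + 1) → ℤ) : ℤ :=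
  ∑ i, ((D.word.get i).side : ℤ) * (X i.castSucc + X i.succ) *
    (Y (D.opp i).castSucc + Y (D.opp i).succ)

/-- The flow along the boundary of a combination of complementary regions. -/
def bankFlow (f : D.Dart → ℤ) (k : Fin (D.word.length + 1)) : ℤ := f (k, true) - f (k, false)

variable {D} {f : D.Dart → ℤ}

/-- The four equations correspond to the four corners at the crossing. -/
theorem banks_at_crossing (hf : ∀ a b, D.TurnLeft a b → f a = f b) (i : Fin D.word.length)
    (hi : (D.word.get i).side = 1) :
    f (i.castSucc, true) = f ((D.opp i).succ, true) ∧
    f (i.succ, false) = f ((D.opp i).castSucc, false) ∧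
    f ((D.opp i).castSucc, true) = f (i.castSucc, false) ∧
    f ((D.opp i).succ, false) = f (i.succ, true) := by
  have h1 := D.get_opp i
  have h2 : D.word.get i = (D.word.get (D.opp i)).other := by rw [h1, other_other]
  have hj : (D.word.get (D.opp i)).side = -1 := by rw [h1, side_other, hi]
  exact ⟨hf _ _ (.fwd_pos i _ h1 hi), hf _ _ (.bwd_pos i _ h1 hi), hf _ _ (.fwd_neg _ i h2 hj),
    hf _ _ (.bwd_neg _ i h2 hj)⟩

/-- To prove a symmetric property of the crossings it is enough to consider one passage. -/
theorem crossing_induction {p : Fin D.word.length → Prop} (hp : ∀ i, p i → p (D.opp i))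
    (h : ∀ i, (D.word.get i).side = 1 → p i) (i : Fin D.word.length) : p i := by
  rcases Int.units_eq_one_or (D.word.get i).side with hi | hi
  · exact h i hi
  · rw [← D.opp_opp i]
    exact hp _ (h _ (by rw [D.get_opp, side_other, hi]; rfl))

theorem isFlow_bankFlow (hf : ∀ a b, D.TurnLeft a b → f a = f b) : D.IsFlow (D.bankFlow f) := by
  refine crossing_induction (fun i h => ?_) fun i hi => ?_
  · rw [D.opp_opp, h, neg_neg]
  · obtain ⟨h1, h2, h3, h4⟩ := banks_at_crossing hf i hi
    simp only [bankFlow, h1, h2, h3, h4]; ring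

theorem sum_succ_sub_castSucc {m : ℕ} (G : Fin (m + 1) → ℤ) :
    ∑ i : Fin m, (G i.succ - G i.castSucc) = G (Fin.last m) - G 0 := by
  have h1 := Fin.sum_univ_succ G
  have h2 := Fin.sum_univ_castSucc G
  rw [Finset.sum_sub_distrib]; linarith

/-- A boundary has zero intersection number with a cycle, apart from what happens at the two ends of
the diagram. Those end terms are kept here and disposed of by `hends` in `card_circles_le`. -/
theorem flowPairing_bankFlow (hf : ∀ a b, D.TurnLeft a b → f a = f b)
    {Y : Fin (D.word.length + 1) → ℤ} (hY : D.IsFlow Y) :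
    D.flowPairing (D.bankFlow f) Y =
      2 * (Y (Fin.last _) * (f (Fin.last _, true) + f (Fin.last _, false)) -
        Y 0 * (f (0, true) + f (0, false))) := by
  set T : Fin D.word.length → ℤ := fun i => ((D.word.get i).side : ℤ) *
    (D.bankFlow f i.castSucc + D.bankFlow f i.succ) *
    (Y (D.opp i).castSucc + Y (D.opp i).succ) with hT
  set G : Fin (D.word.length + 1) → ℤ := fun k => Y k * (f (k, true) + f (k, false)) with hG
  -- Only the sum over both passages of a crossing is a sum of differences of `G`; summing over all
  -- passages then telescopes.
  have key : ∀ i, T i + T (D.opp i) =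
      2 * (G i.succ - G i.castSucc) + 2 * (G (D.opp i).succ - G (D.opp i).castSucc) := by
    refine crossing_induction (fun i h => ?_) fun i hi => ?_
    · rw [D.opp_opp]; linarith
    · obtain ⟨h1, h2, h3, h4⟩ := banks_at_crossing hf i hi
      have hj : (D.word.get (D.opp i)).side = -1 := by rw [D.get_opp, side_other, hi]
      have hk := hY i
      simp only [hT, hG, bankFlow, D.opp_opp, hi, hj, h1, h2, h3, h4]
      push_cast
      have e : Y (D.opp i).succ = Y (D.opp i).castSucc - Y i.succ + Y i.castSucc := by linarith
      rw [e]; ring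
  have hsum : ∑ i, (T i + T (D.opp i)) = ∑ i, (2 * (G i.succ - G i.castSucc) +
      2 * (G (D.opp i).succ - G (D.opp i).castSucc)) := Finset.sum_congr rfl fun i _ => key i
  rw [Finset.sum_add_distrib, Finset.sum_add_distrib, Equiv.sum_comp D.opp T,
    Equiv.sum_comp D.opp (fun i => 2 * (G i.succ - G i.castSucc)), ← Finset.mul_sum,
    sum_succ_sub_castSucc] at hsum
  have : D.flowPairing (D.bankFlow f) Y = ∑ i, T i := rfl
  rw [this]; simp only [hG] at hsum; linarith

/-- The jump at an under-passage is opposite to that at the matching over-passage. So flows form a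
module of rank at most the number of crossings plus one, the extra coordinate being the start value.
-/
theorem flow_eq_zero {Z : Fin (D.word.length + 1) → ℤ} (hZ : D.IsFlow Z) (h0 : Z 0 = 0)
    (hover : ∀ i : Fin D.word.length, (D.word.get i).isOver = true → Z i.succ - Z i.castSucc = 0) :
    Z = 0 := by
  have hjump : ∀ i : Fin D.word.length, Z i.succ - Z i.castSucc = 0 := by
    intro i
    cases h : (D.word.get i).isOver
    · have h1 := hover (D.opp i) (by rw [D.get_opp]; simp [other] at h ⊢; exact h)
      have h2 := hZ i
      omega
    · exact hover i h
  funext k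
  induction k using Fin.induction with
  | zero => exact h0
  | succ i ih => have := hjump i; simp only [Pi.zero_apply] at ih ⊢; omega

/-- With no flow, `f` agrees on both banks of every edge, hence on all corners of every crossing,
and it is constant because the diagram is connected. -/
theorem eq_zero_of_bankFlow_eq_zero (hf : ∀ a b, D.TurnLeft a b → f a = f b)
    (h : D.bankFlow f = 0) (h0 : f (0, true) = 0) : f = 0 := by
  have hb : ∀ k, f (k, true) = f (k, false) := fun k => sub_eq_zero.1 (congrFun h k)
  have hs : ∀ i : Fin D.word.length, f (i.succ, true) = f (i.castSucc, true) ∧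
      f ((D.opp i).succ, true) = f ((D.opp i).castSucc, true) := by
    refine crossing_induction (fun i h => ?_) fun i hi => ?_
    · rw [D.opp_opp]; exact h.symm
    · obtain ⟨h1, h2, h3, h4⟩ := banks_at_crossing hf i hi
      simp only [← hb] at h2 h3 h4
      constructor <;> omega
  have ht : ∀ k, f (k, true) = 0 := by
    intro k
    induction k using Fin.induction with
    | zero => exact h0
    | succ i ih => rw [(hs i).1, ih]
  funext ⟨k, b⟩
  cases b
  · rw [← hb, ht]; rfl
  · exact ht k

theorem flowPairing_sum_add {ι : Type*} [Fintype ι] (a : ι → ℤ)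
    (x : ι → Fin (D.word.length + 1) → ℤ) (X Y : Fin (D.word.length + 1) → ℤ) :
    D.flowPairing (fun k => ∑ r, a r * x r k + X k) Y =
      ∑ r, a r * D.flowPairing (x r) Y + D.flowPairing X Y := by
  simp only [flowPairing, Finset.mul_sum]
  rw [Finset.sum_comm, ← Finset.sum_add_distrib]
  refine Finset.sum_congr rfl fun i _ => ?_
  have : ∑ r, a r * (((D.word.get i).side : ℤ) * (x r i.castSucc + x r i.succ) *
      (Y (D.opp i).castSucc + Y (D.opp i).succ)) = ((D.word.get i).side : ℤ) *
      (∑ r, a r * x r i.castSucc + ∑ r, a r * x r i.succ) *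
      (Y (D.opp i).castSucc + Y (D.opp i).succ) := by
    rw [← Finset.sum_add_distrib, Finset.mul_sum, Finset.sum_mul]
    exact Finset.sum_congr rfl fun r _ => by ring
  rw [this]; ring

theorem isFlow_sum_add {ι : Type*} [Fintype ι] (a : ι → ℤ)
    {x : ι → Fin (D.word.length + 1) → ℤ} {X : Fin (D.word.length + 1) → ℤ}
    (hx : ∀ r, D.IsFlow (x r)) (hX : D.IsFlow X) :
    D.IsFlow (fun k => ∑ r, a r * x r k + X k) := by
  intro i
  have h : ∑ r, (a r * x r (D.opp i).succ - a r * x r (D.opp i).castSucc) =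
      ∑ r, -(a r * x r i.succ - a r * x r i.castSucc) := by
    refine Finset.sum_congr rfl fun r _ => ?_
    linear_combination a r * hx r i
  rw [Finset.sum_sub_distrib, Finset.sum_neg_distrib, Finset.sum_sub_distrib] at h
  have := hX i
  simp only
  linarith

theorem card_isOver : Fintype.card {i // (D.word.get i).isOver = true} = D.numCrossings := by
  have h : ∀ l : List GaussLetter, l.countP (fun x => x.isOver) =
      (l.map fun x => if x.isOver then 1 else 0).sum := by
    intro l
    induction l with
    | nil => rfl
    | cons x l ih => rw [List.countP_cons, ih, List.map_cons, List.sum_cons, add_comm]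
  rw [numCrossings, h, Fintype.card_subtype, Finset.card_filter,
    ← Fin.sum_univ_fun_getElem D.word (fun x => if x.isOver then 1 else 0)]
  rfl

/-- If the flows `x r` are linearly independent modulo the flows which pair trivially with the
flows `y s`, there are few boundary circles. -/
theorem card_circles_le {ι κ : Type*} [Fintype ι] (R : D.Dart → D.Dart → Prop)
    (hR : ∀ a b, D.TurnLeft a b → R a b) (e : ℕ)
    (x : ι → Fin (D.word.length + 1) → ℤ) (y : κ → Fin (D.word.length + 1) → ℤ)
    (hx : ∀ r, D.IsFlow (x r)) (hy : ∀ s, D.IsFlow (y s))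
    (hind : ∀ a : ι → ℤ, (∀ s, ∑ r, a r * D.flowPairing (x r) (y s) = 0) → a = 0)
    (hstart : e = 0 → (∀ r, x r 0 = 0) ∧
      ∀ f : D.Dart → ℤ, (∀ a b, R a b → f a = f b) → f (0, true) = f (0, false))
    (hends : ∀ f : D.Dart → ℤ, (∀ a b, R a b → f a = f b) → ∀ s,
      y s (Fin.last _) * (f (Fin.last _, true) + f (Fin.last _, false)) =
        y s 0 * (f (0, true) + f (0, false))) :
    Fintype.card ι + Nat.card (Quot R) ≤ D.numCrossings + e + 1 := by
  classical
  have : Finite (Quot R) := Quot.finite R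
  have := Fintype.ofFinite (Quot R)
  -- The given combination of cycles plus the boundary of a combination of circles.
  let Z : (ι → ℤ) × (Quot R → ℤ) → Fin (D.word.length + 1) → ℤ := fun p k =>
    ∑ r, p.1 r * x r k + D.bankFlow (fun a => p.2 (Quot.mk R a)) k
  have hZ : ∀ p q k, Z (p + q) k = Z p k + Z q k := by
    intro p q k
    simp only [Z, bankFlow, Prod.fst_add, Prod.snd_add, Pi.add_apply, add_mul,
      Finset.sum_add_distrib]
    ring
  -- The coordinates of the flow, together with one value of `f` to detect the constants, whose
  -- boundary is zero. The start value is recorded only if `e = 1`; for `e = 0` it vanishes.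
  let Ψ : (ι → ℤ) × (Quot R → ℤ) →+
      ℤ × (Fin e → ℤ) × ({i // (D.word.get i).isOver = true} → ℤ) :=
    AddMonoidHom.mk' (fun p => (p.2 (Quot.mk R (0, true)), fun _ => Z p 0,
      fun i => Z p i.1.succ - Z p i.1.castSucc)) (by
        intro p q
        refine Prod.ext rfl (Prod.ext ?_ ?_)
        · funext _; simp only [hZ]; rfl
        · funext i; simp only [hZ, Prod.snd_add, Pi.add_apply]; ring)
  have hinj : Function.Injective Ψ.toIntLinearMap := by
    rw [AddMonoidHom.coe_toIntLinearMap, injective_iff_map_eq_zero]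
    intro p hp
    have hp0 : p.2 (Quot.mk R (0, true)) = 0 := congrArg (·.1) hp
    have hp1 : ∀ j : Fin e, Z p 0 = 0 := fun j => congrFun (congrArg (·.2.1) hp) j
    have hp2 : ∀ i, (D.word.get i).isOver = true → Z p i.succ - Z p i.castSucc = 0 :=
      fun i hi => congrFun (congrArg (·.2.2) hp) ⟨i, hi⟩
    set f : D.Dart → ℤ := fun a => p.2 (Quot.mk R a) with hfdef
    have hfR : ∀ a b, R a b → f a = f b := fun a b h => congrArg p.2 (Quot.sound h)
    have hf : ∀ a b, D.TurnLeft a b → f a = f b := fun a b h => hfR a b (hR a b h)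
    have hflow := isFlow_sum_add p.1 hx (isFlow_bankFlow hf)
    have h0 : Z p 0 = 0 := by
      rcases Nat.eq_zero_or_pos e with he | he
      · obtain ⟨h1, h2⟩ := hstart he
        simp only [Z, h1, bankFlow]
        simpa [sub_eq_zero] using h2 f hfR
      · exact hp1 ⟨0, he⟩
    have hZ0 : Z p = 0 := flow_eq_zero hflow h0 hp2
    have ha : p.1 = 0 := by
      -- Pairing with `y s` kills the boundary part, so the coefficients of the cycles satisfy the
      -- equations of `hind`.
      refine hind _ fun s => ?_
      have h1 := flowPairing_sum_add p.1 x (D.bankFlow f) (y s)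
      rw [flowPairing_bankFlow hf (hy s), hends f hfR s, sub_self, mul_zero, add_zero] at h1
      rw [← h1]
      change D.flowPairing (Z p) (y s) = 0
      rw [hZ0]; simp [flowPairing]
    have hbank : D.bankFlow f = 0 := by
      funext k
      have := congrFun hZ0 k
      simpa [Z, ha] using this
    have hf0 := eq_zero_of_bankFlow_eq_zero hf hbank hp0
    refine Prod.ext ha ?_
    funext q
    induction q using Quot.ind with
    | mk a => exact congrFun hf0 a
  have := LinearMap.finrank_le_finrank_of_injective hinj
  simp only [Module.finrank_prod, Module.finrank_fintype_fun_eq_card, Module.finrank_self,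
    Fintype.card_fin, card_isOver, ← Nat.card_eq_fintype_card (α := Quot R)] at this
  omega

theorem card_closedCircle_le {ι κ : Type*} [Fintype ι]
    (x : ι → Fin (D.word.length + 1) → ℤ) (y : κ → Fin (D.word.length + 1) → ℤ)
    (hx : ∀ r, D.IsFlow (x r)) (hy : ∀ s, D.IsFlow (y s))
    (hy' : ∀ s, y s (Fin.last _) = y s 0)
    (hind : ∀ a : ι → ℤ, (∀ s, ∑ r, a r * D.flowPairing (x r) (y s) = 0) → a = 0) :
    Fintype.card ι + Nat.card D.ClosedCircle ≤ D.numCrossings + 2 := by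
  refine card_circles_le D.ClosedStep (fun _ _ => .turn) 1 x y hx hy hind (by simp) ?_
  intro f hf s
  rw [hy', hf _ _ .through_fwd, ← hf _ _ .through_bwd]

theorem card_tangleCircle_le {ι κ : Type*} [Fintype ι]
    (x : ι → Fin (D.word.length + 1) → ℤ) (y : κ → Fin (D.word.length + 1) → ℤ)
    (hx : ∀ r, D.IsFlow (x r)) (hy : ∀ s, D.IsFlow (y s)) (hx0 : ∀ r, x r 0 = 0)
    (hy0 : ∀ s, y s 0 = 0) (hy' : ∀ s, y s (Fin.last _) = 0)
    (hind : ∀ a : ι → ℤ, (∀ s, ∑ r, a r * D.flowPairing (x r) (y s) = 0) → a = 0) :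
    Fintype.card ι + Nat.card D.TangleCircle ≤ D.numCrossings + 1 := by
  refine card_circles_le D.TangleStep (fun _ _ => .turn) 0 x y hx hy hind
    (fun _ => ⟨hx0, fun f hf => (hf _ _ .around_start).symm⟩) ?_
  intro f hf s
  rw [hy', hy0]; simp

end LongGaussDiagram

/-! ### Euler characteristics and supporting genus -/

namespace ComplementaryRegions

/-- A region with `k ≥ 1` boundary circles has Euler characteristic at most `2 - k ≤ k`; disks
attain equality. -/
theorem eulerChar_le {C : Type} [Finite C] (R : ComplementaryRegions C) :
    R.eulerChar ≤ Nat.card C := by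
  classical
  have := Fintype.ofFinite C
  have h : (Nat.card C : ℤ) = ∑ r, (Nat.card {c : C // R.region c = r} : ℤ) := by
    rw [← Nat.cast_sum, ← Nat.card_sigma, Nat.card_congr (Equiv.sigmaFiberEquiv R.region)]
  rw [h, eulerChar]
  refine Finset.sum_le_sum fun r _ => ?_
  have : 0 < Nat.card {c : C // R.region c = r} := by
    obtain ⟨c, hc⟩ := R.region_surjective r
    exact Nat.card_pos_iff.2 ⟨⟨c, hc⟩, inferInstance⟩
  have := Int.natCast_nonneg (R.regionGenus r)
  omega

/-- The complementary regions that are all disks. -/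
noncomputable def disks (C : Type) [Finite C] : ComplementaryRegions C where
  numRegions := Nat.card C
  region := Finite.equivFin C
  region_surjective := (Finite.equivFin C).surjective
  regionGenus := 0

theorem eulerChar_disks (C : Type) [Finite C] : (disks C).eulerChar = Nat.card C := by
  have h : ∀ r, Nat.card {c : C // (disks C).region c = r} = 1 := by
    intro r
    rw [Nat.card_eq_one_iff_unique]
    have hu := (Finite.equivFin C).bijective.existsUnique r
    obtain ⟨c, hc, hu⟩ := hu
    exact ⟨⟨fun a b => Subtype.ext ((hu _ a.2).trans (hu _ b.2).symm)⟩, ⟨⟨c, hc⟩⟩⟩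
  have h0 : ∀ r, (disks C).regionGenus r = 0 := fun _ => rfl
  simp only [eulerChar, h, h0]
  simp only [Finset.sum_const, Finset.card_univ, Fintype.card_fin]
  simp [disks]

end ComplementaryRegions

namespace LongGaussDiagram

variable {D : LongGaussDiagram}

instance : Finite D.ClosedCircle := Quot.finite _

instance : Finite D.TangleCircle := Quot.finite _

theorem _root_.ClosedRealization.le_card (S : ClosedRealization D) :
    D.numCrossings + 2 ≤ Nat.card D.ClosedCircle + 2 * S.genus := by
  have := S.euler; have := S.regions.eulerChar_le; omega

theorem _root_.TangleRealization.le_card (S : TangleRealization D) :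
    D.numCrossings + 1 ≤ Nat.card D.TangleCircle + 2 * S.genus := by
  have := S.euler; have := S.regions.eulerChar_le; omega

theorem toKnot_mem_K1 {g : ℕ} (h : D.numCrossings + 2 = Nat.card D.ClosedCircle + 2 * g) :
    D.toKnot ∈ LongVirtualKnot.K1 g := by
  let S : ClosedRealization D := ⟨.disks _, g, by
    rw [ComplementaryRegions.eulerChar_disks]; omega⟩
  change D.toKnot.sg1 ≤ g
  unfold LongVirtualKnot.sg1
  exact iInf_le_of_le D (iInf_le_of_le rfl (iInf_le_of_le S le_rfl))

theorem toKnot_mem_K2 {g : ℕ} (h : D.numCrossings + 1 = Nat.card D.TangleCircle + 2 * g) :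
    D.toKnot ∈ LongVirtualKnot.K2 g := by
  let S : TangleRealization D := ⟨.disks _, g, by
    rw [ComplementaryRegions.eulerChar_disks]; omega⟩
  change D.toKnot.sg2 ≤ g
  unfold LongVirtualKnot.sg2
  exact iInf_le_of_le D (iInf_le_of_le rfl (iInf_le_of_le S le_rfl))

end LongGaussDiagram

namespace LongVirtualKnot

theorem exists_of_mem_K1 {K : LongVirtualKnot} {g : ℕ} (h : K ∈ K1 g) :
    ∃ D : LongGaussDiagram, D.toKnot = K ∧
      D.numCrossings + 2 ≤ Nat.card D.ClosedCircle + 2 * g := by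
  -- A strict bound on the infimum yields an actual realization.
  have h : K.sg1 < (g + 1 : ℕ) := lt_of_le_of_lt h (by exact_mod_cast Nat.lt_succ_self g)
  simp only [sg1, iInf_lt_iff] at h
  obtain ⟨D, hD, S, hS⟩ := h
  have hS : S.genus < g + 1 := by exact_mod_cast hS
  have := S.le_card
  exact ⟨D, hD, by omega⟩

theorem exists_of_mem_K2 {K : LongVirtualKnot} {g : ℕ} (h : K ∈ K2 g) :
    ∃ D : LongGaussDiagram, D.toKnot = K ∧
      D.numCrossings + 1 ≤ Nat.card D.TangleCircle + 2 * g := by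
  have h : K.sg2 < (g + 1 : ℕ) := lt_of_le_of_lt h (by exact_mod_cast Nat.lt_succ_self g)
  simp only [sg2, iInf_lt_iff] at h
  obtain ⟨D, hD, S, hS⟩ := h
  have hS : S.genus < g + 1 := by exact_mod_cast hS
  have := S.le_card
  exact ⟨D, hD, by omega⟩

end LongVirtualKnot

/-! ### Level functions as flows; rank bounds for knots -/

namespace LongGaussDiagram

open GaussLetter GaussWord

variable (D : LongGaussDiagram) {d d' : GaussLetter → ℤ} {c c' : ℤ}

/-- The level function with jumps `d` and start value `c`. -/
def level (d : GaussLetter → ℤ) (c : ℤ) (k : Fin (D.word.length + 1)) : ℤ :=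
  c + ((D.word.take k).map d).sum

theorem level_succ (i : Fin D.word.length) :
    D.level d c i.succ = D.level d c i.castSucc + d (D.word.get i) := by
  simp only [level, Fin.val_succ, Fin.val_castSucc, List.take_succ_eq_append_getElem i.2,
    List.map_append, List.sum_append, List.get_eq_getElem]
  simp [add_assoc]

theorem level_zero : D.level d c 0 = c := by simp [level]

theorem sum_map_eq_zero (hd : ∀ x, d x.other = -d x) : (D.word.map d).sum = 0 := by
  have h1 : (D.word.map d).sum = ∑ i, d (D.word.get i) :=
    (Fin.sum_univ_fun_getElem D.word d).symm
  have h2 := Equiv.sum_comp D.opp fun i => d (D.word.get i)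
  simp only [D.get_opp, hd, Finset.sum_neg_distrib] at h2
  omega

theorem level_last (hd : ∀ x, d x.other = -d x) : D.level d c (Fin.last _) = c := by
  simp [level, D.sum_map_eq_zero hd]

theorem isFlow_level (hd : ∀ x, d x.other = -d x) : D.IsFlow (D.level d c) := by
  intro i
  rw [level_succ, level_succ, D.get_opp, hd]; ring

theorem doubleLevel_get (i : Fin D.word.length) :
    doubleLevel d c D.word (D.word.get i) = D.level d c i.castSucc + D.level d c i.succ := by
  have h : D.word = D.word.take i ++ [D.word.get i] ++ D.word.drop (i + 1) := by simp
  have hn := D.nodup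
  rw [h, List.nodup_append, List.nodup_append] at hn
  have hm : D.word.get i ∉ D.word.take i := fun hh => hn.1.2.2 _ hh _ (by simp) rfl
  have key := doubleLevel_block (d := d) (c := c) (v := D.word.drop (i + 1)) hm
    (List.mem_singleton_self _)
  rw [← h] at key
  rw [key, level_succ]
  simp [doubleLevel, level]; ring

theorem flowPairing_level : D.flowPairing (D.level d c) (D.level d' c') =
    pairing d c d' c' D.word := by
  rw [pairing, ← Fin.sum_univ_fun_getElem D.word
    (fun x => (x.side : ℤ) * doubleLevel d c D.word x * doubleLevel d' c' D.word x.other)]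
  refine Finset.sum_congr rfl fun i _ => ?_
  have h1 := D.doubleLevel_get (d := d) (c := c) i
  have h2 := D.doubleLevel_get (d := d') (c := c') (D.opp i)
  rw [D.get_opp] at h2
  simp only [List.get_eq_getElem] at h1 h2 ⊢
  rw [h1, h2]

theorem flowPairing_jump (φ ψ : Bool → ℤ → ℤ) :
    D.flowPairing (D.level (jump φ D.word) c) (D.level (jump ψ D.word) c') =
      D.toKnot.loopPairing φ c ψ c' := D.flowPairing_level

end LongGaussDiagram

namespace LongVirtualKnot

open LongGaussDiagram GaussWord

/-- Weighted sums of loops, shifted by multiples of the whole knot, that are independent modulo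
the radical of the intersection form bound the number of boundary circles. -/
theorem card_closedCircle_le {ι κ : Type*} [Fintype ι] (D : LongGaussDiagram)
    (x : ι → (Bool → ℤ → ℤ) × ℤ) (y : κ → (Bool → ℤ → ℤ) × ℤ)
    (hind : ∀ a : ι → ℤ, (∀ s, ∑ r, a r *
      D.toKnot.loopPairing (x r).1 (x r).2 (y s).1 (y s).2 = 0) → a = 0) :
    Fintype.card ι + Nat.card D.ClosedCircle ≤ D.numCrossings + 2 := by
  have hO := fun φ => jump_other φ D.word
  refine LongGaussDiagram.card_closedCircle_le (fun r => D.level (jump (x r).1 D.word) (x r).2)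
    (fun s => D.level (jump (y s).1 D.word) (y s).2) (fun r => D.isFlow_level (hO _))
    (fun r => D.isFlow_level (hO _)) (fun s => ?_) ?_
  · rw [D.level_last (hO _), D.level_zero]
  · simpa only [D.flowPairing_jump] using hind

theorem card_tangleCircle_le {ι κ : Type*} [Fintype ι] (D : LongGaussDiagram)
    (x : ι → Bool → ℤ → ℤ) (y : κ → Bool → ℤ → ℤ)
    (hind : ∀ a : ι → ℤ, (∀ s, ∑ r, a r *
      D.toKnot.loopPairing (x r) 0 (y s) 0 = 0) → a = 0) :
    Fintype.card ι + Nat.card D.TangleCircle ≤ D.numCrossings + 1 := by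
  have hO := fun φ => jump_other φ D.word
  refine LongGaussDiagram.card_tangleCircle_le (fun r => D.level (jump (x r) D.word) 0)
    (fun s => D.level (jump (y s) D.word) 0) (fun r => D.isFlow_level (hO _))
    (fun r => D.isFlow_level (hO _)) (fun r => D.level_zero) (fun s => D.level_zero)
    (fun s => D.level_last (hO _)) ?_
  simpa only [D.flowPairing_jump] using hind

end LongVirtualKnot

namespace LongGaussDiagram

open GaussLetter GaussWord

variable (D : LongGaussDiagram)

theorem flowPairing_antisymm (X Y : Fin (D.word.length + 1) → ℤ) :
    D.flowPairing X Y = -D.flowPairing Y X := by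
  rw [flowPairing, ← Equiv.sum_comp D.opp, flowPairing, ← Finset.sum_neg_distrib]
  refine Finset.sum_congr rfl fun i _ => ?_
  rw [D.get_opp, D.opp_opp, side_other]
  push_cast; ring

theorem isFirst_get (i : Fin D.word.length) :
    IsFirst D.word (D.word.get i) ↔ i < D.opp i := by
  have hl : ∀ k, D.level (Pi.single (D.word.get i) 1) 0 k = if i.castSucc < k then 1 else 0 := by
    intro k
    induction k using Fin.induction with
    | zero => simp [level_zero]
    | succ j ih =>
      rw [level_succ, ih, Pi.single_apply]
      simp only [D.get_injective.eq_iff, Fin.lt_def, Fin.val_castSucc, Fin.val_succ, Fin.ext_iff]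
      split_ifs <;> omega
  have hne : D.opp i ≠ i := fun h => other_ne (D.word.get i) (by rw [← D.get_opp, h])
  rw [IsFirst, ← D.get_opp, D.doubleLevel_get, hl, hl]
  simp only [Fin.lt_def, Fin.val_castSucc, Fin.val_succ, ne_eq, Fin.ext_iff] at hne ⊢
  split_ifs <;> omega

theorem length_word : D.word.length = 2 * D.numCrossings := by
  have h := D.sum_map_eq_zero (d := fun x => if x.isOver then 1 else -1) fun x => by
    cases h : x.isOver <;> simp [other, h]
  have h2 : ∀ l : List GaussLetter, (l.map fun x => if x.isOver then (1 : ℤ) else -1).sum =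
      2 * (l.countP fun x => x.isOver) - l.length := by
    intro l
    induction l with
    | nil => rfl
    | cons x l ih =>
      rw [List.map_cons, List.sum_cons, ih, List.countP_cons, List.length_cons]
      push_cast; split_ifs <;> ring
  rw [h2] at h
  simp only [numCrossings]; omega

theorem le_card_quot {R : D.Dart → D.Dart → Prop} (lab : D.Dart → ℕ)
    (hlab : ∀ a b, R a b → lab a = lab b) (n : ℕ) (hsurj : ∀ i < n, ∃ a, lab a = i) :
    n ≤ Nat.card (Quot R) := by
  have := Quot.finite R
  choose g hg using hsurj
  have h := Nat.card_le_card_of_injective (fun i : Fin n => Quot.mk R (g i i.2)) ?_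
  · simpa using h
  · intro i j hij
    have := congrArg (Quot.lift lab hlab) hij
    simp only [hg] at this
    exact Fin.ext this

end LongGaussDiagram

theorem LongVirtualKnot.loopPairing_antisymm (φ ψ : Bool → ℤ → ℤ) (c c' : ℤ)
    (K : LongVirtualKnot) : K.loopPairing φ c ψ c' = -K.loopPairing ψ c' φ c := by
  induction K using Quot.ind with
  | mk D =>
    have h1 := D.flowPairing_jump (c := c) (c' := c') φ ψ
    have h2 := D.flowPairing_jump (c := c') (c' := c) ψ φ
    rw [LongGaussDiagram.toKnot] at h1 h2
    rw [← h1, ← h2, D.flowPairing_antisymm]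

theorem LongVirtualKnot.loopPairing_self (φ : Bool → ℤ → ℤ) (c : ℤ)
    (K : LongVirtualKnot) : K.loopPairing φ c φ c = 0 := by
  have := K.loopPairing_antisymm φ φ c c
  omega

/-! ### The twisted diagrams -/

/-- The passages of a family of long virtual knots: two strands are twisted around each other with
crossings `0, …, N`, where the sign `η` of the last one may be irregular; then there may follow
two further crossings. -/
def twistLetter (N : ℕ) (η : ℤˣ) (i : ℕ) : GaussLetter :=
  if i ≤ N then ⟨i, decide (i % 2 = 0), if i = N then η else 1⟩
  else if i < 2 * N + 2 then
    ⟨i - (N + 1), decide ((i - (N + 1)) % 2 = 1), if i = 2 * N + 1 then η else 1⟩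
  else if i = 2 * N + 2 then ⟨N + 1, true, 1⟩
  else if i = 2 * N + 3 then ⟨N + 2, false, 1⟩
  else if i = 2 * N + 4 then ⟨N + 1, false, 1⟩
  else ⟨N + 2, true, 1⟩

/-- The position of the other passage through the same crossing. -/
def twistOpp (N i : ℕ) : ℕ :=
  if i ≤ N then i + (N + 1) else if i < 2 * N + 2 then i - (N + 1)
  else if i < 2 * N + 4 then i + 2 else i - 2

/-- The position of a passage. -/
def twistIndex (N : ℕ) (x : GaussLetter) : ℕ :=
  if x.label ≤ N then
    if x.isOver = decide (x.label % 2 = 0) then x.label else x.label + (N + 1)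
  else if x.label = N + 1 then if x.isOver then 2 * N + 2 else 2 * N + 4
  else if x.isOver then 2 * N + 5 else 2 * N + 3

variable {N : ℕ} {η : ℤˣ} {i : ℕ}

theorem twist_cases {p : ℕ → Prop} (h₁ : ∀ j < N, p j) (h₂ : p N) (h₃ : ∀ j < N, p (N + 1 + j))
    (h₄ : p (2 * N + 1)) (h₅ : p (2 * N + 2)) (h₆ : p (2 * N + 3)) (h₇ : p (2 * N + 4))
    (h₈ : p (2 * N + 5)) : ∀ i < 2 * N + 6, p i := by
  intro i hi
  have : i < N ∨ i = N ∨ (N < i ∧ i < 2 * N + 1) ∨ i = 2 * N + 1 ∨ i = 2 * N + 2 ∨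
    i = 2 * N + 3 ∨ i = 2 * N + 4 ∨ i = 2 * N + 5 := by omega
  rcases this with h | rfl | h | rfl | rfl | rfl | rfl | rfl
  · exact h₁ i h
  · exact h₂
  · have := h₃ (i - (N + 1)) (by omega)
    rwa [Nat.add_sub_cancel' (by omega)] at this
  all_goals assumption

section Letters

variable {j : ℕ}

theorem twistLetter_fst (h : j < N) : twistLetter N η j = ⟨j, decide (j % 2 = 0), 1⟩ := by
  simp (disch := omega) only [twistLetter, if_pos, if_neg]

theorem twistLetter_last_fst (hN : N % 2 = 1) : twistLetter N η N = ⟨N, false, η⟩ := by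
  simp [twistLetter, hN]

theorem twistLetter_snd (h : j < N) :
    twistLetter N η (N + 1 + j) = ⟨j, decide (j % 2 = 1), 1⟩ := by
  simp (disch := omega) only [twistLetter, if_pos, if_neg, Nat.add_sub_cancel_left]

theorem twistLetter_last_snd (hN : N % 2 = 1) :
    twistLetter N η (2 * N + 1) = ⟨N, true, η⟩ := by
  have e : 2 * N + 1 - (N + 1) = N := by omega
  simp (disch := omega) only [twistLetter, if_pos, if_neg, if_true, e, hN]
  simp

theorem twistLetter_two : twistLetter N η (2 * N + 2) = ⟨N + 1, true, 1⟩ := by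
  simp (disch := omega) only [twistLetter, if_pos, if_neg, if_true]

theorem twistLetter_three : twistLetter N η (2 * N + 3) = ⟨N + 2, false, 1⟩ := by
  simp (disch := omega) only [twistLetter, if_pos, if_neg, if_true]

theorem twistLetter_four : twistLetter N η (2 * N + 4) = ⟨N + 1, false, 1⟩ := by
  simp (disch := omega) only [twistLetter, if_pos, if_neg, if_true]

theorem twistLetter_five : twistLetter N η (2 * N + 5) = ⟨N + 2, true, 1⟩ := by
  simp (disch := omega) only [twistLetter, if_pos, if_neg]

theorem twistOpp_fst (h : j ≤ N) : twistOpp N j = N + 1 + j := by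
  simp (disch := omega) only [twistOpp, if_pos]; omega

theorem twistOpp_snd (h : j ≤ N) : twistOpp N (N + 1 + j) = j := by
  simp (disch := omega) only [twistOpp, if_pos, if_neg]; omega

theorem twistOpp_last_fst : twistOpp N N = 2 * N + 1 := by
  rw [twistOpp_fst le_rfl]; omega

theorem twistOpp_last_snd : twistOpp N (2 * N + 1) = N := by
  have := twistOpp_snd (le_refl N)
  rwa [show N + 1 + N = 2 * N + 1 by omega] at this

theorem twistOpp_two : twistOpp N (2 * N + 2) = 2 * N + 4 := by
  simp (disch := omega) only [twistOpp, if_pos, if_neg]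

theorem twistOpp_three : twistOpp N (2 * N + 3) = 2 * N + 5 := by
  simp (disch := omega) only [twistOpp, if_pos, if_neg]

theorem twistOpp_four : twistOpp N (2 * N + 4) = 2 * N + 2 := by
  simp (disch := omega) only [twistOpp, if_neg]; omega

theorem twistOpp_five : twistOpp N (2 * N + 5) = 2 * N + 3 := by
  simp (disch := omega) only [twistOpp, if_neg]; omega

end Letters

theorem twistIndex_twistLetter (hN : N % 2 = 1) :
    ∀ i < 2 * N + 6, twistIndex N (twistLetter N η i) = i := by
  refine twist_cases (fun j h => ?_) ?_ (fun j h => ?_) ?_ ?_ ?_ ?_ ?_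
  · simp (disch := omega) only [twistLetter_fst h, twistIndex, if_pos, if_true]
  · simp [twistLetter_last_fst hN, twistIndex, hN]
  · rw [twistLetter_snd h]
    have : decide (j % 2 = 1) ≠ decide (j % 2 = 0) := by
      rcases Nat.mod_two_eq_zero_or_one j with h | h <;> simp [h]
    simp only [twistIndex, h.le, if_true, if_neg this]; omega
  · simp [twistLetter_last_snd hN, twistIndex, hN]; omega
  · simp [twistLetter_two, twistIndex]
  · simp [twistLetter_three, twistIndex]
  · simp [twistLetter_four, twistIndex]
  · simp [twistLetter_five, twistIndex]

theorem twistLetter_other (hN : N % 2 = 1) :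
    ∀ i < 2 * N + 6, (twistLetter N η i).other = twistLetter N η (twistOpp N i) := by
  refine twist_cases (fun j h => ?_) ?_ (fun j h => ?_) ?_ ?_ ?_ ?_ ?_
  · rw [twistOpp_fst h.le, twistLetter_fst h, twistLetter_snd h]
    rcases Nat.mod_two_eq_zero_or_one j with h | h <;> simp [h, GaussLetter.other]
  · rw [twistOpp_last_fst, twistLetter_last_fst hN, twistLetter_last_snd hN]; rfl
  · rw [twistOpp_snd h.le, twistLetter_fst h, twistLetter_snd h]
    rcases Nat.mod_two_eq_zero_or_one j with h | h <;> simp [h, GaussLetter.other]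
  · rw [twistOpp_last_snd, twistLetter_last_fst hN, twistLetter_last_snd hN]; rfl
  · rw [twistOpp_two, twistLetter_two, twistLetter_four]; rfl
  · rw [twistOpp_three, twistLetter_three, twistLetter_five]; rfl
  · rw [twistOpp_four, twistLetter_two, twistLetter_four]; rfl
  · rw [twistOpp_five, twistLetter_three, twistLetter_five]; rfl

theorem sign_twistLetter : (twistLetter N η i).sign =
    if (twistLetter N η i).label = N then η else 1 := by
  unfold twistLetter
  split_ifs <;> simp_all <;> omega

theorem side_fst {j : ℕ} (h : j < N) :
    ((twistLetter N η j).side : ℤ) = if j % 2 = 0 then 1 else -1 := by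
  rw [twistLetter_fst h, GaussLetter.side]
  rcases Nat.mod_two_eq_zero_or_one j with h | h <;> simp [h]

theorem side_last_fst (hN : N % 2 = 1) : ((twistLetter N η N).side : ℤ) = -η := by
  rw [twistLetter_last_fst hN]; simp [GaussLetter.side]

theorem side_snd {j : ℕ} (h : j < N) :
    ((twistLetter N η (N + 1 + j)).side : ℤ) = if j % 2 = 0 then -1 else 1 := by
  rw [twistLetter_snd h, GaussLetter.side]
  rcases Nat.mod_two_eq_zero_or_one j with h | h <;> simp [h]

theorem side_last_snd (hN : N % 2 = 1) : ((twistLetter N η (2 * N + 1)).side : ℤ) = η := by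
  rw [twistLetter_last_snd hN]; simp [GaussLetter.side]

theorem side_two : ((twistLetter N η (2 * N + 2)).side : ℤ) = 1 := by
  rw [twistLetter_two]; simp [GaussLetter.side]

theorem side_three : ((twistLetter N η (2 * N + 3)).side : ℤ) = -1 := by
  rw [twistLetter_three]; simp [GaussLetter.side]

theorem side_four : ((twistLetter N η (2 * N + 4)).side : ℤ) = -1 := by
  rw [twistLetter_four]; simp [GaussLetter.side]

theorem side_five : ((twistLetter N η (2 * N + 5)).side : ℤ) = 1 := by
  rw [twistLetter_five]; simp [GaussLetter.side]

theorem twistLetter_injOn (hN : N % 2 = 1) {i j : ℕ} (hi : i < 2 * N + 6) (hj : j < 2 * N + 6)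
    (h : twistLetter N η i = twistLetter N η j) : i = j := by
  rw [← twistIndex_twistLetter (η := η) hN i hi, h, twistIndex_twistLetter hN j hj]

/-- The diagram with the first `2 * N + 2 + t` of the passages `twistLetter N η i`. -/
def twistDiagram (N : ℕ) (η : ℤˣ) (t : ℕ) (hN : N % 2 = 1) (ht : t = 0 ∨ t = 4) :
    LongGaussDiagram where
  word := (List.range (2 * N + 2 + t)).map (twistLetter N η)
  nodup := by
    refine List.Nodup.map_on (fun i hi j hj h => ?_) List.nodup_range
    rw [List.mem_range] at hi hj
    exact twistLetter_injOn hN (by omega) (by omega) h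
  other_mem := by
    intro x hx
    obtain ⟨i, hi, rfl⟩ := List.mem_map.1 hx
    rw [List.mem_range] at hi
    rw [twistLetter_other hN i (by omega)]
    refine List.mem_map_of_mem (List.mem_range.2 ?_)
    unfold twistOpp; split_ifs <;> omega
  sign_eq := by
    intro x hx y hy h
    obtain ⟨i, -, rfl⟩ := List.mem_map.1 hx
    obtain ⟨j, -, rfl⟩ := List.mem_map.1 hy
    rw [sign_twistLetter, sign_twistLetter, h]

/-! ### Indices and jumps of the twisted diagrams -/

namespace twistDiagram

open LongGaussDiagram GaussWord

variable {t : ℕ} {hN : N % 2 = 1} {ht : t = 0 ∨ t = 4}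

theorem length_word : (twistDiagram N η t hN ht).word.length = 2 * N + 2 + t := by
  simp [twistDiagram]

theorem numCrossings : (twistDiagram N η t hN ht).numCrossings = N + 1 + t / 2 := by
  have h1 := (twistDiagram N η t hN ht).length_word
  rw [length_word] at h1
  omega

theorem get (i : Fin (twistDiagram N η t hN ht).word.length) :
    (twistDiagram N η t hN ht).word.get i = twistLetter N η i := by
  have h : (twistDiagram N η t hN ht).word = (List.range (2 * N + 2 + t)).map (twistLetter N η) :=
    rfl
  rw [List.get_eq_getElem, List.getElem_of_eq h, List.getElem_map, List.getElem_range]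

theorem lt_length (i : Fin (twistDiagram N η t hN ht).word.length) : (i : ℕ) < 2 * N + 2 + t :=
  i.2.trans_eq length_word

theorem eq_twistOpp {i j : Fin (twistDiagram N η t hN ht).word.length}
    (h : (twistDiagram N η t hN ht).word.get j = ((twistDiagram N η t hN ht).word.get i).other) :
    (j : ℕ) = twistOpp N i := by
  have hi := lt_length i
  have hj := lt_length j
  rw [get, get, twistLetter_other hN _ (by omega)] at h
  refine twistLetter_injOn hN (by omega) ?_ h
  unfold twistOpp; split_ifs <;> omega

theorem opp_eq (i : Fin (twistDiagram N η t hN ht).word.length) :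
    ((twistDiagram N η t hN ht).opp i : ℕ) = twistOpp N i := eq_twistOpp (get_opp _ i)

theorem level_eq {d : GaussLetter → ℤ} {c : ℤ} (X : ℕ → ℤ) (h0 : X 0 = c)
    (h : ∀ i < 2 * N + 2 + t, X (i + 1) = X i + d (twistLetter N η i))
    (k : Fin ((twistDiagram N η t hN ht).word.length + 1)) :
    (twistDiagram N η t hN ht).level d c k = X k := by
  induction k using Fin.induction with
  | zero => rw [level_zero]; exact h0.symm
  | succ i ih => rw [level_succ, ih, get, Fin.val_succ, h _ (lt_length i)]; rfl

/-- The sum of the sides of the passages before an edge. -/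
def sideLevel (N : ℕ) (η : ℤˣ) (i : ℕ) : ℤ :=
  if i ≤ N then ((i % 2 : ℕ) : ℤ)
  else if i ≤ 2 * N + 1 then 1 - η - ((i % 2 : ℕ) : ℤ)
  else if i = 2 * N + 3 then 1 else if i = 2 * N + 5 then -1 else 0

theorem doubleLevel_side (i : Fin (twistDiagram N η t hN ht).word.length) :
    doubleLevel (fun y => (y.side : ℤ)) 0 (twistDiagram N η t hN ht).word
      (twistLetter N η i) = sideLevel N η i + sideLevel N η (i + 1) := by
  have h := level_eq (η := η) (t := t) (hN := hN) (ht := ht)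
    (d := fun y => (y.side : ℤ)) (c := 0) (sideLevel N η) rfl ?_
  · have h1 := doubleLevel_get (twistDiagram N η t hN ht) (d := fun y => (y.side : ℤ)) (c := 0) i
    rw [get, h, h] at h1
    exact h1
  · intro i hi
    revert i
    suffices h : ∀ i < 2 * N + 6, sideLevel N η (i + 1) =
        sideLevel N η i + (twistLetter N η i).side from fun i hi => h i (by omega)
    refine twist_cases (fun j h => ?_) ?_ (fun j h => ?_) ?_ ?_ ?_ ?_ ?_
    · rw [side_fst h]; simp (disch := omega) only [sideLevel, if_pos]; split_ifs <;> omega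
    · rw [side_last_fst hN]; simp (disch := omega) only [sideLevel, if_pos, if_neg]; omega
    · rw [side_snd h]; simp (disch := omega) only [sideLevel, if_pos, if_neg]
      split_ifs <;> omega
    · rw [side_last_snd hN]; simp (disch := omega) only [sideLevel, if_pos, if_neg]; omega
    · rw [side_two]; simp (disch := omega) only [sideLevel, if_neg, if_true]; omega
    · rw [side_three]; simp (disch := omega) only [sideLevel, if_neg, if_true]; omega
    · rw [side_four]; simp (disch := omega) only [sideLevel, if_neg, if_true]; omega
    · rw [side_five]; simp (disch := omega) only [sideLevel, if_neg, if_true]; omega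

theorem weight_eq (φ : Bool → ℤ → ℤ) {i : ℕ} (hi : i < 2 * N + 2 + t) :
    weight φ (twistDiagram N η t hN ht).word (twistLetter N η i) =
    if i < twistOpp N i then (twistLetter N η i).sign * φ (twistLetter N η i).isOver
      (sideLevel N η (twistOpp N i) + sideLevel N η (twistOpp N i + 1) -
        (sideLevel N η i + sideLevel N η (i + 1))) else 0 := by
  obtain ⟨i, rfl⟩ : ∃ i' : Fin (twistDiagram N η t hN ht).word.length, (i' : ℕ) = i :=
    ⟨⟨i, by rwa [length_word]⟩, rfl⟩
  have hF := (twistDiagram N η t hN ht).isFirst_get i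
  rw [get, Fin.lt_def, opp_eq] at hF
  have h1 := doubleLevel_side i
  have h2 := doubleLevel_side ((twistDiagram N η t hN ht).opp i)
  rw [opp_eq, ← twistLetter_other hN _ (by omega)] at h2
  rw [weight, doubleIndex, h1, h2]
  simp only [hF]

/-- The jumps of weighted sums of loops. -/
def twistJump (φ : Bool → ℤ → ℤ) (N : ℕ) (η : ℤˣ) (i : ℕ) : ℤ :=
  if i < N then φ (decide (i % 2 = 0)) (-2 * η)
  else if i = N then η * φ false (-2)
  else if i ≤ 2 * N then -φ (decide (i % 2 = 0)) (-2 * η)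
  else if i = 2 * N + 1 then -(η * φ false (-2))
  else if i = 2 * N + 2 then φ true (-2) else if i = 2 * N + 3 then φ false (-2)
  else if i = 2 * N + 4 then -φ true (-2) else -φ false (-2)

theorem jump_eq (φ : Bool → ℤ → ℤ) (i : ℕ) (hi₀ : i < 2 * N + 2 + t) :
    jump φ (twistDiagram N η t hN ht).word (twistLetter N η i) = twistJump φ N η i := by
  have hi' : twistOpp N i < 2 * N + 2 + t := by
    have := opp_eq (hN := hN) (ht := ht) (η := η) ⟨i, by rwa [length_word]⟩
    rw [← this]; exact lt_length _
  rw [jump, twistLetter_other hN i (by omega), weight_eq φ hi₀, weight_eq φ hi']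
  have hi : i < 2 * N + 6 := by omega
  clear hi' hi₀
  revert i
  refine twist_cases (fun j h => ?_) ?_ (fun j h => ?_) ?_ ?_ ?_ ?_ ?_
  · rw [twistOpp_fst h.le, twistOpp_snd h.le, twistLetter_fst h]
    simp (disch := omega) only [sideLevel, twistJump, if_pos, if_neg]
    simp only [Units.val_one, one_mul, sub_zero]
    congr 1
    omega
  · rw [twistOpp_last_fst, twistOpp_last_snd, twistLetter_last_fst hN]
    simp (disch := omega) only [sideLevel, twistJump, if_pos, if_neg, if_true]
    simp only [sub_zero]
    congr 2
    omega
  · rw [twistOpp_snd h.le, twistOpp_fst h.le, twistLetter_fst h]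
    simp (disch := omega) only [sideLevel, twistJump, if_pos, if_neg]
    have e : (N + 1 + j) % 2 = 0 ↔ j % 2 = 0 := by omega
    simp only [Units.val_one, one_mul, zero_sub, e]
    congr 2
    omega
  · rw [twistOpp_last_snd, twistOpp_last_fst, twistLetter_last_fst hN]
    simp (disch := omega) only [sideLevel, twistJump, if_pos, if_neg, if_true]
    simp only [zero_sub]
    congr 3
    omega
  · rw [twistOpp_two, twistOpp_four, twistLetter_two]
    simp (disch := omega) only [sideLevel, twistJump, if_pos, if_neg, if_true]
    simp
  · rw [twistOpp_three, twistOpp_five, twistLetter_three]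
    simp (disch := omega) only [sideLevel, twistJump, if_pos, if_neg, if_true]
    simp
  · rw [twistOpp_four, twistOpp_two, twistLetter_two]
    simp (disch := omega) only [sideLevel, twistJump, if_pos, if_neg, if_true]
    simp
  · rw [twistOpp_five, twistOpp_three, twistLetter_three]
    simp (disch := omega) only [sideLevel, twistJump, if_pos, if_neg, if_true]
    simp

end twistDiagram

variable {N : ℕ} {η : ℤˣ}

/-! ### Intersection numbers in the examples -/

namespace twistDiagram

open LongGaussDiagram GaussWord

variable {t : ℕ} {hN : N % 2 = 1} {ht : t = 0 ∨ t = 4} {φ ψ : Bool → ℤ → ℤ} {c c' : ℤ}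

theorem loopPairing_eq (X Y : ℕ → ℤ) (hX₀ : X 0 = c) (hY₀ : Y 0 = c')
    (hX : ∀ i < 2 * N + 2 + t, X (i + 1) = X i + twistJump φ N η i)
    (hY : ∀ i < 2 * N + 2 + t, Y (i + 1) = Y i + twistJump ψ N η i) :
    (twistDiagram N η t hN ht).toKnot.loopPairing φ c ψ c' =
      ∑ i ∈ Finset.range (2 * N + 2 + t), ((twistLetter N η i).side : ℤ) * (X i + X (i + 1)) *
        (Y (twistOpp N i) + Y (twistOpp N i + 1)) := by
  have hX' := level_eq (hN := hN) (ht := ht) (d := jump φ (twistDiagram N η t hN ht).word) X hX₀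
    fun i hi => by rw [jump_eq _ i hi, hX i hi]
  have hY' := level_eq (hN := hN) (ht := ht) (d := jump ψ (twistDiagram N η t hN ht).word) Y hY₀
    fun i hi => by rw [jump_eq _ i hi, hY i hi]
  rw [← flowPairing_jump, flowPairing]
  simp only [hX', hY', Fin.val_castSucc, Fin.val_succ, opp_eq, get]
  rw [Fin.sum_univ_eq_sum_range (fun i => ((twistLetter N η i).side : ℤ) * (X i + X (i + 1)) *
    (Y (twistOpp N i) + Y (twistOpp N i + 1))), length_word]

theorem sum_range_twist (f : ℕ → ℤ) : ∑ i ∈ Finset.range (2 * N + 2), f i =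
    ∑ j ∈ Finset.range N, f j + f N + ∑ j ∈ Finset.range N, f (N + 1 + j) + f (2 * N + 1) := by
  rw [show 2 * N + 2 = (N + 1) + (N + 1) by omega, Finset.sum_range_add, Finset.sum_range_succ,
    Finset.sum_range_succ, show N + 1 + N = 2 * N + 1 by omega]
  ring

theorem sum_alternating (hN : N % 2 = 1) :
    ∑ j ∈ Finset.range N, (if j % 2 = 0 then (1 : ℤ) else -1) = 1 ∧
    2 * ∑ j ∈ Finset.range N, (if j % 2 = 0 then (1 : ℤ) else -1) * (j + 1) = N + 1 := by
  obtain ⟨k, rfl⟩ : ∃ k, N = 2 * k + 1 := ⟨N / 2, by omega⟩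
  clear hN
  induction k with
  | zero => simp
  | succ k ih =>
    have e1 : (2 * k + 1) % 2 ≠ 0 := by omega
    have e2 : (2 * k + 1 + 1) % 2 = 0 := by omega
    rw [show 2 * (k + 1) + 1 = 2 * k + 1 + 1 + 1 by ring, Finset.sum_range_succ,
      Finset.sum_range_succ, ih.1, Finset.sum_range_succ, Finset.sum_range_succ, mul_add, mul_add,
      ih.2, if_neg e1, if_pos e2]
    refine ⟨by norm_num, ?_⟩
    push_cast; ring

/-- The level function of the sum of the loops at the crossings `0, 2, …, N - 1`. -/
def evenLevel (N i : ℕ) : ℤ :=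
  if i ≤ N then ((i + 1) / 2 : ℕ)
  else if i ≤ 2 * N + 1 then ((N + 1) / 2 : ℕ) - ((i - N) / 2 : ℕ) else 0

/-- The level function of the difference of the loops at the crossings `N + 2` and `N`. -/
def lastLevel (N i : ℕ) : ℤ :=
  if i ≤ N then 0 else if i ≤ 2 * N + 1 then -1
  else if i = 2 * N + 4 ∨ i = 2 * N + 5 then 1 else 0

/-- The level function of the loop at the crossing `N + 1`. -/
def extraLevel (N i : ℕ) : ℤ := if i = 2 * N + 3 ∨ i = 2 * N + 4 then 1 else 0

/-- The weight must pick out exactly the twist crossings that are first met over. Hypothesis `h₄`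
keeps out crossing `N + 1`, which is also first met over, when it is present. -/
theorem evenLevel_succ (hN : N % 2 = 1) (h₁ : φ true (-2 * η) = 1) (h₂ : φ false (-2 * η) = 0)
    (h₃ : φ false (-2) = 0) (h₄ : t = 0 ∨ φ true (-2) = 0) (ht : t = 0 ∨ t = 4) :
    ∀ i < 2 * N + 2 + t, evenLevel N (i + 1) = evenLevel N i + twistJump φ N η i := by
  have hφ : ∀ j : ℕ, φ (decide (j % 2 = 0)) (-2 * η) = 1 - (j % 2 : ℕ) := by
    intro j
    rcases Nat.mod_two_eq_zero_or_one j with h | h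
    · simp only [h, decide_true, h₁]; rfl
    · simp only [h, one_ne_zero, decide_false, h₂]; rfl
  suffices h : ∀ i < 2 * N + 6, i < 2 * N + 2 + t →
      evenLevel N (i + 1) = evenLevel N i + twistJump φ N η i from
    fun i hi => h i (by omega) hi
  refine twist_cases (fun j h _ => ?_) (fun _ => ?_) (fun j h _ => ?_) (fun _ => ?_)
    (fun h => ?_) (fun h => ?_) (fun h => ?_) (fun h => ?_) <;>
    simp (disch := omega) only [evenLevel, twistJump, if_pos, if_neg, if_true, hφ, h₃]
  · omega
  · omega
  · omega
  · omega
  · rw [h₄.resolve_left (by omega)]; rfl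
  · rfl
  · rw [h₄.resolve_left (by omega)]; rfl
  · rfl

theorem lastLevel_succ (h₁ : ∀ b, φ b (-2 * (-1 : ℤˣ)) = 0) (h₂ : φ true (-2) = 0)
    (h₃ : φ false (-2) = 1) :
    ∀ i < 2 * N + 6, lastLevel N (i + 1) = lastLevel N i + twistJump φ N (-1) i := by
  refine twist_cases (fun j h => ?_) ?_ (fun j h => ?_) ?_ ?_ ?_ ?_ ?_ <;>
    simp (disch := omega) only [lastLevel, twistJump, if_pos, if_neg, if_true, h₁, h₂, h₃, or_true,
      true_or] <;>
    rfl

theorem extraLevel_succ (h₁ : ∀ b, φ b (-2 * (-1 : ℤˣ)) = 0) (h₂ : φ true (-2) = 1)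
    (h₃ : φ false (-2) = 0) :
    ∀ i < 2 * N + 6, extraLevel N (i + 1) = extraLevel N i + twistJump φ N (-1) i := by
  refine twist_cases (fun j h => ?_) ?_ (fun j h => ?_) ?_ ?_ ?_ ?_ ?_ <;>
    simp (disch := omega) only [extraLevel, twistJump, if_pos, if_neg, if_true, h₁, h₂, h₃, or_true,
      true_or] <;>
    rfl

theorem const_succ (c : ℤ) : ∀ i < 2 * N + 2 + t, (fun _ => c) (i + 1) =
    (fun _ => c) i + twistJump 0 N η i := by
  intro i _
  simp [twistJump]

theorem evenLevel_add (hN : N % 2 = 1) {j : ℕ} :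
    (j ≤ N → evenLevel N j + evenLevel N (j + 1) = j + 1) ∧
    (j ≤ N → evenLevel N (N + 1 + j) + evenLevel N (N + 1 + j + 1) = N - j) ∧
    (2 * N + 1 ≤ j → evenLevel N j + evenLevel N (j + 1) = 0) := by
  simp only [evenLevel]
  refine ⟨fun h => ?_, fun h => ?_, fun h => ?_⟩ <;> split_ifs <;> omega

theorem lastLevel_add {j : ℕ} :
    (j < N → lastLevel N j + lastLevel N (j + 1) = 0) ∧
    (j < N → lastLevel N (N + 1 + j) + lastLevel N (N + 1 + j + 1) = -2) := by
  simp only [lastLevel]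
  refine ⟨fun h => ?_, fun h => ?_⟩ <;> split_ifs <;> omega

/-- The weight of crossings of type `b` and double index `n`. -/
def select (b : Bool) (n : ℤ) : Bool → ℤ → ℤ := fun b' n' => if b' = b ∧ n' = n then 1 else 0

/-- Each of the `(N + 1) / 2` selected loops has index `-1`, that is, meets the knot `-1` times. -/
theorem pairing_even_const (hN : N % 2 = 1) :
    (twistDiagram N 1 0 hN (.inl rfl)).toKnot.loopPairing (select true (-2)) 0 0 1 =
      -2 * (N + 1) := by
  have hs := sum_alternating hN
  rw [loopPairing_eq (evenLevel N) (fun _ => 1) (c := 0) (c' := 1) rfl rfl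
    (evenLevel_succ hN (by simp [select]) (by simp [select]) (by simp [select]) (.inl rfl)
      (.inl rfl))
    (const_succ 1), add_zero, sum_range_twist, side_last_fst hN, (evenLevel_add hN).1 le_rfl,
    (evenLevel_add hN).2.2 le_rfl]
  have e1 : ∑ j ∈ Finset.range N, ((twistLetter N 1 j).side : ℤ) *
      (evenLevel N j + evenLevel N (j + 1)) * (1 + 1) =
      2 * ∑ j ∈ Finset.range N, (if j % 2 = 0 then (1 : ℤ) else -1) * (j + 1) := by
    rw [Finset.mul_sum]
    refine Finset.sum_congr rfl fun j hj => ?_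
    rw [Finset.mem_range] at hj
    rw [side_fst hj, (evenLevel_add hN).1 hj.le]; ring
  -- On the second strand the sides are opposite and the doubled level is `N - j = (N + 1) - (j +
  -- 1)`, so both alternating sums appear.
  have e2 : ∑ j ∈ Finset.range N, ((twistLetter N 1 (N + 1 + j)).side : ℤ) *
      (evenLevel N (N + 1 + j) + evenLevel N (N + 1 + j + 1)) * (1 + 1) =
      2 * ∑ j ∈ Finset.range N, (if j % 2 = 0 then (1 : ℤ) else -1) * (j + 1) -
        2 * (N + 1) * ∑ j ∈ Finset.range N, (if j % 2 = 0 then (1 : ℤ) else -1) := by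
    rw [Finset.mul_sum, Finset.mul_sum, ← Finset.sum_sub_distrib]
    refine Finset.sum_congr rfl fun j hj => ?_
    rw [Finset.mem_range] at hj
    rw [side_snd hj, (evenLevel_add hN).2.1 hj.le]
    split_ifs <;> ring
  rw [e1, e2, hs.1, hs.2]
  push_cast; ring

section Virtual

variable (hN : N % 2 = 1) (ht : t = 0 ∨ t = 4)

/-- For `η = -1` the regular twist crossings have double index `2` and the irregular one `-2`, so
the index separates the two families of loops. Crossing `N + 2` is selected with the latter, but the
even level vanishes there. -/
theorem pairing_even_last :
    (twistDiagram N (-1) t hN ht).toKnot.loopPairing (select true 2) 0 (select false (-2)) 0 =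
      -2 * (N + 1) := by
  have hs := sum_alternating hN
  rw [loopPairing_eq (evenLevel N) (lastLevel N) (c := 0) (c' := 0) rfl rfl
    (evenLevel_succ hN (by simp [select]) (by simp [select]) (by simp [select])
      (.inr (by simp [select])) ht)
    fun i hi => lastLevel_succ (by simp [select]) (by simp [select]) (by simp [select]) i
      (by omega)]
  have e0 : ∑ i ∈ Finset.range t, ((twistLetter N (-1) (2 * N + 2 + i)).side : ℤ) *
      (evenLevel N (2 * N + 2 + i) + evenLevel N (2 * N + 2 + i + 1)) *
      (lastLevel N (twistOpp N (2 * N + 2 + i)) + lastLevel N (twistOpp N (2 * N + 2 + i) + 1))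
      = 0 := Finset.sum_eq_zero fun i _ => by
    rw [(evenLevel_add hN).2.2 (by omega)]; ring
  have e1 : ∑ j ∈ Finset.range N, ((twistLetter N (-1) j).side : ℤ) *
      (evenLevel N j + evenLevel N (j + 1)) *
      (lastLevel N (twistOpp N j) + lastLevel N (twistOpp N j + 1)) =
      - (2 * ∑ j ∈ Finset.range N, (if j % 2 = 0 then (1 : ℤ) else -1) * (j + 1)) := by
    rw [Finset.mul_sum, ← Finset.sum_neg_distrib]
    refine Finset.sum_congr rfl fun j hj => ?_
    rw [Finset.mem_range] at hj
    rw [side_fst hj, (evenLevel_add hN).1 hj.le, twistOpp_fst hj.le, lastLevel_add.2 hj]; ring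
  have e2 : ∑ j ∈ Finset.range N, ((twistLetter N (-1) (N + 1 + j)).side : ℤ) *
      (evenLevel N (N + 1 + j) + evenLevel N (N + 1 + j + 1)) *
      (lastLevel N (twistOpp N (N + 1 + j)) + lastLevel N (twistOpp N (N + 1 + j) + 1)) = 0 := by
    refine Finset.sum_eq_zero fun j hj => ?_
    rw [Finset.mem_range] at hj
    rw [twistOpp_snd hj.le, lastLevel_add.1 hj, mul_zero]
  have e3 : lastLevel N (2 * N + 1) + lastLevel N (2 * N + 1 + 1) = -1 := by
    simp only [lastLevel]; split_ifs <;> omega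
  rw [Finset.sum_range_add, e0, sum_range_twist, e1, e2, twistOpp_last_fst, e3,
    side_last_fst hN, (evenLevel_add hN).1 le_rfl, (evenLevel_add hN).2.2 le_rfl, hs.2]
  push_cast; ring

theorem pairing_even_extra :
    (twistDiagram N (-1) 4 hN (.inr rfl)).toKnot.loopPairing (select true 2) 0
      (select true (-2)) 0 = 0 := by
  rw [loopPairing_eq (evenLevel N) (extraLevel N) (c := 0) (c' := 0) rfl rfl
    (evenLevel_succ hN (by simp [select]) (by simp [select]) (by simp [select])
      (.inr (by simp [select])) (.inr rfl))
    (extraLevel_succ (by simp [select]) (by simp [select]) (by simp [select]))]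
  refine Finset.sum_eq_zero fun i hi => ?_
  rcases lt_or_ge i (2 * N + 1) with h | h
  · have : extraLevel N (twistOpp N i) + extraLevel N (twistOpp N i + 1) = 0 := by
      simp only [extraLevel, twistOpp]; split_ifs <;> omega
    rw [this, mul_zero]
  · rw [(evenLevel_add hN).2.2 h]; ring

theorem sum_tail (f : ℕ → ℤ) (h : ∀ i < 2 * N + 2, f i = 0) :
    ∑ i ∈ Finset.range (2 * N + 2 + 4), f i =
      f (2 * N + 2) + f (2 * N + 3) + f (2 * N + 4) + f (2 * N + 5) := by
  rw [Finset.sum_range_add, Finset.sum_eq_zero fun i hi => h i (Finset.mem_range.1 hi)]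
  simp [Finset.sum_range_succ, add_assoc]

/-- Only the loops at `N + 1` and `N + 2` overlap, and in the annular summand loops do not meet
algebraically. -/
theorem pairing_last_extra :
    (twistDiagram N (-1) 4 hN (.inr rfl)).toKnot.loopPairing (select false (-2)) 0
      (select true (-2)) 0 = 0 := by
  rw [loopPairing_eq (lastLevel N) (extraLevel N) (c := 0) (c' := 0) rfl rfl
    (lastLevel_succ (by simp [select]) (by simp [select]) (by simp [select]))
    (extraLevel_succ (by simp [select]) (by simp [select]) (by simp [select])), sum_tail]
  · rw [side_two, side_three, side_four, side_five, twistOpp_two, twistOpp_three, twistOpp_four,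
      twistOpp_five]
    simp (disch := omega) only [lastLevel, extraLevel, if_neg]
    norm_num
  · intro i hi
    have : extraLevel N (twistOpp N i) + extraLevel N (twistOpp N i + 1) = 0 := by
      simp only [extraLevel, twistOpp]; split_ifs <;> omega
    rw [this, mul_zero]

theorem pairing_extra_const :
    (twistDiagram N (-1) 4 hN (.inr rfl)).toKnot.loopPairing (select true (-2)) 0 0 1 = -4 := by
  rw [loopPairing_eq (extraLevel N) (fun _ => 1) (c := 0) (c' := 1) rfl rfl
    (extraLevel_succ (by simp [select]) (by simp [select]) (by simp [select])) (const_succ 1),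
    sum_tail]
  · rw [side_two, side_three, side_four, side_five]
    simp (disch := omega) only [extraLevel, if_neg]
    norm_num
  · intro i hi
    have : extraLevel N i + extraLevel N (i + 1) = 0 := by
      simp only [extraLevel]; split_ifs <;> omega
    rw [this]; ring

end Virtual

end twistDiagram

variable {N : ℕ} {η : ℤˣ}

/-! ### Exhibiting boundary circles -/

namespace twistDiagram

open LongGaussDiagram GaussWord

variable {t : ℕ} {hN : N % 2 = 1} {ht : t = 0 ∨ t = 4}

/-- A labelling `l` of left banks and `r` of right banks is compatible with left turns at the
passage `i`. -/
def TurnCompatible (N : ℕ) (η : ℤˣ) (l r : ℕ → ℕ) (i : ℕ) : Prop :=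
  (((twistLetter N η i).side : ℤ) = 1 →
    l i = l (twistOpp N i + 1) ∧ r (i + 1) = r (twistOpp N i)) ∧
  (((twistLetter N η i).side : ℤ) = -1 →
    l i = r (twistOpp N i) ∧ r (i + 1) = l (twistOpp N i + 1))

/-- The labelling of the darts. -/
def dartLabel (l r : ℕ → ℕ) (a : (twistDiagram N η t hN ht).Dart) : ℕ :=
  if a.2 then l a.1 else r a.1

theorem dartLabel_turn {l r : ℕ → ℕ} (h : ∀ i < 2 * N + 2 + t, TurnCompatible N η l r i)
    (a b : (twistDiagram N η t hN ht).Dart) (hab : TurnLeft _ a b) :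
    dartLabel l r a = dartLabel l r b := by
  cases hab with
  | fwd_pos i j hj hi =>
    rw [get] at hi
    have := ((h i (lt_length i)).1 (by rw [hi]; rfl)).1
    simpa [dartLabel, eq_twistOpp hj] using this
  | fwd_neg i j hj hi =>
    rw [get] at hi
    have := ((h i (lt_length i)).2 (by rw [hi]; rfl)).1
    simpa [dartLabel, eq_twistOpp hj] using this
  | bwd_pos i j hj hi =>
    rw [get] at hi
    have := ((h i (lt_length i)).1 (by rw [hi]; rfl)).2
    simpa [dartLabel, eq_twistOpp hj] using this
  | bwd_neg i j hj hi =>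
    rw [get] at hi
    have := ((h i (lt_length i)).2 (by rw [hi]; rfl)).2
    simpa [dartLabel, eq_twistOpp hj] using this

theorem exists_dartLabel {l r : ℕ → ℕ} {n : ℕ}
    (h : ∃ k < 2 * N + 3 + t, l k = n ∨ r k = n) :
    ∃ a : (twistDiagram N η t hN ht).Dart, dartLabel l r a = n := by
  obtain ⟨k, hk, h | h⟩ := h
  · exact ⟨(⟨k, by rw [length_word]; omega⟩, true), by simpa [dartLabel] using h⟩
  · exact ⟨(⟨k, by rw [length_word]; omega⟩, false), by simpa [dartLabel] using h⟩

theorem le_card_closedCircle {l r : ℕ → ℕ} {n : ℕ}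
    (h : ∀ i < 2 * N + 2 + t, TurnCompatible N η l r i)
    (hl : l (2 * N + 2 + t) = l 0) (hr : r 0 = r (2 * N + 2 + t))
    (hn : ∀ i < n, ∃ k < 2 * N + 3 + t, l k = i ∨ r k = i) :
    n ≤ Nat.card (twistDiagram N η t hN ht).ClosedCircle := by
  refine le_card_quot _ (dartLabel l r) (fun a b hab => ?_) n fun i hi => exists_dartLabel (hn i hi)
  cases hab with
  | turn h' => exact dartLabel_turn h _ _ h'
  | through_fwd => simpa [dartLabel, length_word] using hl
  | through_bwd => simpa [dartLabel, length_word] using hr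

theorem le_card_tangleCircle {l r : ℕ → ℕ} {n : ℕ}
    (h : ∀ i < 2 * N + 2 + t, TurnCompatible N η l r i)
    (hl : l (2 * N + 2 + t) = r (2 * N + 2 + t)) (hr : r 0 = l 0)
    (hn : ∀ i < n, ∃ k < 2 * N + 3 + t, l k = i ∨ r k = i) :
    n ≤ Nat.card (twistDiagram N η t hN ht).TangleCircle := by
  refine le_card_quot _ (dartLabel l r) (fun a b hab => ?_) n fun i hi => exists_dartLabel (hn i hi)
  cases hab with
  | turn h' => exact dartLabel_turn h _ _ h'
  | around_end => simpa [dartLabel, length_word] using hl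
  | around_start => simpa [dartLabel, length_word] using hr

theorem TurnCompatible.of_side_one {l r : ℕ → ℕ} {i j : ℕ}
    (hs : ((twistLetter N η i).side : ℤ) = 1) (hj : twistOpp N i = j)
    (hl : l i = l (j + 1)) (hr : r (i + 1) = r j) : TurnCompatible N η l r i :=
  ⟨fun _ => ⟨hj ▸ hl, hj ▸ hr⟩, fun h => by rw [hs] at h; norm_num at h⟩

theorem TurnCompatible.of_side_neg_one {l r : ℕ → ℕ} {i j : ℕ}
    (hs : ((twistLetter N η i).side : ℤ) = -1) (hj : twistOpp N i = j)
    (hl : l i = r j) (hr : r (i + 1) = l (j + 1)) : TurnCompatible N η l r i :=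
  ⟨fun h => by rw [hs] at h; norm_num at h, fun _ => ⟨hj ▸ hl, hj ▸ hr⟩⟩

/-- The labels of the left (`p = 1`) or right (`p = 0`) banks: the bigons between the first `T + 1`
crossings are labelled `2, …, T + 1`. -/
def bigonLabel (N T p : ℕ) (o : ℕ → ℕ) (k : ℕ) : ℕ :=
  if 1 ≤ k ∧ k ≤ T ∧ k % 2 = p then k + 1
  else if N + 2 ≤ k ∧ k ≤ N + 1 + T ∧ k % 2 ≠ p then k - N else o k

/-- There are `N` bigons between consecutive crossings and two further circles, one at each end of
the arc, labelled 0 and 1. -/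
theorem le_card_tangleCircle_annulus :
    N + 2 ≤ Nat.card (twistDiagram N 1 0 hN (.inl rfl)).TangleCircle := by
  let o : ℕ → ℕ := fun k => if k = 2 * N + 2 then 1 else 0
  let o' : ℕ → ℕ := fun k => if k = 0 then 0 else 1
  refine le_card_tangleCircle (l := bigonLabel N N 1 o) (r := bigonLabel N N 0 o') ?_ ?_ ?_ ?_
  · suffices h : ∀ i < 2 * N + 6, i < 2 * N + 2 →
        TurnCompatible N 1 (bigonLabel N N 1 o) (bigonLabel N N 0 o') i from
      fun i hi => h i (by omega) hi
    refine twist_cases (fun j h _ => ?_) (fun _ => ?_) (fun j h _ => ?_) (fun _ => ?_)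
      (fun h => ?_) (fun h => ?_) (fun h => ?_) (fun h => ?_)
    · rcases Nat.mod_two_eq_zero_or_one j with h' | h'
      · refine .of_side_one (by rw [side_fst h, if_pos h']) (twistOpp_fst h.le)
          ?_ ?_ <;>
          simp only [bigonLabel, o, o'] <;> split_ifs <;> omega
      · refine .of_side_neg_one (by rw [side_fst h, if_neg (by omega)]) (twistOpp_fst h.le)
          ?_ ?_ <;>
          simp only [bigonLabel, o, o'] <;> split_ifs <;> omega
    · refine .of_side_neg_one (by rw [side_last_fst hN]; rfl) twistOpp_last_fst ?_ ?_ <;>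
        simp only [bigonLabel, o, o'] <;> split_ifs <;> omega
    · rcases Nat.mod_two_eq_zero_or_one j with h' | h'
      · refine .of_side_neg_one (by rw [side_snd h, if_pos h']) (twistOpp_snd h.le) ?_ ?_ <;>
          simp only [bigonLabel, o, o'] <;> split_ifs <;> omega
      · refine .of_side_one (by rw [side_snd h, if_neg (by omega)]) (twistOpp_snd h.le) ?_ ?_ <;>
          simp only [bigonLabel, o, o'] <;> split_ifs <;> omega
    · refine .of_side_one (by rw [side_last_snd hN]; rfl) twistOpp_last_snd ?_ ?_ <;>
        simp only [bigonLabel, o, o'] <;> split_ifs <;> omega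
    all_goals omega
  · simp only [o, o', bigonLabel]; split_ifs <;> omega
  · simp only [o, o', bigonLabel]; split_ifs <;> omega
  · intro i hi
    rcases Nat.lt_or_ge i 2 with h | h
    · interval_cases i
      · exact ⟨0, by omega, .inr (by simp only [bigonLabel, o']; split_ifs <;> omega)⟩
      · exact ⟨2 * N + 2, by omega, .inr (by simp only [bigonLabel, o']; split_ifs <;> omega)⟩
    · refine ⟨i - 1, by omega, ?_⟩
      simp only [bigonLabel]; split_ifs <;> omega

/-- The irregular crossing destroys the last bigon. There remain `N - 1` bigons and two outer
circles; circle 0 follows the right bank of the outer edges and the left bank of edge `N + 1`. -/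
theorem le_card_closedCircle_torus :
    N + 1 ≤ Nat.card (twistDiagram N (-1) 0 hN (.inl rfl)).ClosedCircle := by
  let o : ℕ → ℕ := fun k => if k = N + 1 then 0 else 1
  let o' : ℕ → ℕ := fun k => if k = 0 then 0 else if k = 2 * N + 2 then 0 else 1
  refine le_card_closedCircle (l := bigonLabel N (N - 1) 1 o) (r := bigonLabel N (N - 1) 0 o')
    ?_ ?_ ?_ ?_
  · suffices h : ∀ i < 2 * N + 6, i < 2 * N + 2 →
        TurnCompatible N (-1) (bigonLabel N (N - 1) 1 o) (bigonLabel N (N - 1) 0 o') i from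
      fun i hi => h i (by omega) hi
    refine twist_cases (fun j h _ => ?_) (fun _ => ?_) (fun j h _ => ?_) (fun _ => ?_)
      (fun h => ?_) (fun h => ?_) (fun h => ?_) (fun h => ?_)
    · rcases Nat.mod_two_eq_zero_or_one j with h' | h'
      · refine .of_side_one (by rw [side_fst h, if_pos h']) (twistOpp_fst h.le)
          ?_ ?_ <;>
          simp only [bigonLabel, o, o'] <;> split_ifs <;> omega
      · refine .of_side_neg_one (by rw [side_fst h, if_neg (by omega)]) (twistOpp_fst h.le)
          ?_ ?_ <;>
          simp only [bigonLabel, o, o'] <;> split_ifs <;> omega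
    · refine .of_side_one (by rw [side_last_fst hN]; rfl) twistOpp_last_fst ?_ ?_ <;>
        simp only [bigonLabel, o, o'] <;> split_ifs <;> omega
    · rcases Nat.mod_two_eq_zero_or_one j with h' | h'
      · refine .of_side_neg_one (by rw [side_snd h, if_pos h']) (twistOpp_snd h.le) ?_ ?_ <;>
          simp only [bigonLabel, o, o'] <;> split_ifs <;> omega
      · refine .of_side_one (by rw [side_snd h, if_neg (by omega)]) (twistOpp_snd h.le) ?_ ?_ <;>
          simp only [bigonLabel, o, o'] <;> split_ifs <;> omega
    · refine .of_side_neg_one (by rw [side_last_snd hN]; rfl) twistOpp_last_snd ?_ ?_ <;>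
        simp only [bigonLabel, o, o'] <;> split_ifs <;> omega
    all_goals omega
  · simp only [o, bigonLabel]; split_ifs <;> omega
  · simp only [o', bigonLabel]; split_ifs <;> omega
  · intro i hi
    rcases Nat.lt_or_ge i 2 with h | h
    · interval_cases i
      · exact ⟨0, by omega, .inr (by simp only [bigonLabel, o']; split_ifs <;> omega)⟩
      · exact ⟨2 * N + 2, by omega, .inl (by simp only [bigonLabel, o]; split_ifs <;> omega)⟩
    · refine ⟨i - 1, by omega, ?_⟩
      simp only [bigonLabel]; split_ifs <;> omega

/-- Besides the `N - 1` bigons of the twist there is the bigon of the annular summand, labelled `N +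
1`, and one circle at each end. All outer banks of the torus part belong to circle 0. -/
theorem le_card_tangleCircle_torus :
    N + 2 ≤ Nat.card (twistDiagram N (-1) 4 hN (.inr rfl)).TangleCircle := by
  obtain ⟨o, ho, ho3, ho4, ho5, ho6⟩ : ∃ o : ℕ → ℕ, (∀ k, k ≤ 2 * N + 2 → o k = 0) ∧
      o (2 * N + 3) = N + 1 ∧ o (2 * N + 4) = 0 ∧ o (2 * N + 5) = 0 ∧ o (2 * N + 6) = 1 := by
    refine ⟨fun k => if k = 2 * N + 3 then N + 1 else if k = 2 * N + 6 then 1 else 0,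
      fun k hk => ?_, ?_, ?_, ?_, ?_⟩ <;> dsimp only <;> split_ifs <;> omega
  obtain ⟨o', ho', ho3', ho4', ho5', ho6'⟩ : ∃ o : ℕ → ℕ, (∀ k, k ≤ 2 * N + 2 → o k = 0) ∧
      o (2 * N + 3) = 1 ∧ o (2 * N + 4) = 1 ∧ o (2 * N + 5) = N + 1 ∧ o (2 * N + 6) = 1 := by
    refine ⟨fun k => if k = 2 * N + 5 then N + 1 else if k ≤ 2 * N + 2 then 0 else 1,
      fun k hk => ?_, ?_, ?_, ?_, ?_⟩ <;> dsimp only <;> split_ifs <;> omega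
  refine le_card_tangleCircle (l := bigonLabel N (N - 1) 1 o) (r := bigonLabel N (N - 1) 0 o')
    ?_ ?_ ?_ ?_
  · refine twist_cases (fun j h => ?_) ?_ (fun j h => ?_) ?_ ?_ ?_ ?_ ?_
    · rcases Nat.mod_two_eq_zero_or_one j with h' | h'
      · refine .of_side_one (by rw [side_fst h, if_pos h']) (twistOpp_fst h.le)
          ?_ ?_ <;>
          simp (disch := omega) only [bigonLabel, ho, ho'] <;> split_ifs <;> omega
      · refine .of_side_neg_one (by rw [side_fst h, if_neg (by omega)]) (twistOpp_fst h.le)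
          ?_ ?_ <;>
          simp (disch := omega) only [bigonLabel, ho, ho'] <;> split_ifs <;> omega
    · refine .of_side_one (by rw [side_last_fst hN]; rfl) twistOpp_last_fst ?_ ?_ <;>
        simp (disch := omega) only [bigonLabel, ho, ho'] <;> split_ifs <;> omega
    · rcases Nat.mod_two_eq_zero_or_one j with h' | h'
      · refine .of_side_neg_one (by rw [side_snd h, if_pos h']) (twistOpp_snd h.le) ?_ ?_ <;>
          simp (disch := omega) only [bigonLabel, ho, ho'] <;> split_ifs <;> omega
      · refine .of_side_one (by rw [side_snd h, if_neg (by omega)]) (twistOpp_snd h.le) ?_ ?_ <;>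
          simp (disch := omega) only [bigonLabel, ho, ho'] <;> split_ifs <;> omega
    · refine .of_side_neg_one (by rw [side_last_snd hN]; rfl) twistOpp_last_snd ?_ ?_ <;>
        simp (disch := omega) only [bigonLabel, ho, ho'] <;> split_ifs <;> omega
    · refine .of_side_one side_two twistOpp_two ?_ ?_ <;>
        simp (disch := omega) only [bigonLabel, if_neg, ho, ho5, ho3', ho4']
    · refine .of_side_neg_one side_three twistOpp_three ?_ ?_ <;>
        simp (disch := omega) only [bigonLabel, if_neg, ho3, ho6, ho4', ho5']
    · refine .of_side_neg_one side_four twistOpp_four ?_ ?_ <;>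
        simp (disch := omega) only [bigonLabel, if_neg, ho', ho3, ho4, ho5']
    · refine .of_side_one side_five twistOpp_five ?_ ?_ <;>
        simp (disch := omega) only [bigonLabel, if_neg, ho4, ho5, ho3', ho6']
  · change bigonLabel N (N - 1) 1 o (2 * N + 6) = bigonLabel N (N - 1) 0 o' (2 * N + 6)
    simp (disch := omega) only [bigonLabel, if_neg, ho6, ho6']
  · simp (disch := omega) only [ho, ho', bigonLabel]; split_ifs <;> omega
  · intro i hi
    rcases Nat.lt_or_ge i 2 with h | h
    · interval_cases i
      · exact ⟨0, by omega, .inr (by simp (disch := omega) only [bigonLabel, ho']; split_ifs <;> omega)⟩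
      · exact ⟨2 * N + 6, by omega, .inr (by simp (disch := omega) only [bigonLabel]; split_ifs <;> omega)⟩
    · rcases Nat.lt_or_ge N i with h' | h'
      · exact ⟨2 * N + 3, by omega, .inl (by simp only [bigonLabel]; split_ifs <;> omega)⟩
      · refine ⟨i - 1, by omega, ?_⟩
        simp only [bigonLabel]; split_ifs <;> omega

end twistDiagram

/-! ### Obstructions to small supporting genus -/

namespace LongVirtualKnot

open LongGaussDiagram GaussWord

variable {K : LongVirtualKnot} {φ ψ χ : Bool → ℤ → ℤ}

theorem notMem_K1_zero (h : K.loopPairing φ 0 0 1 ≠ 0) : K ∉ K1 0 := by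
  intro hK
  obtain ⟨D, rfl, hD⟩ := exists_of_mem_K1 hK
  have := card_closedCircle_le D (fun _ : Unit => (φ, 0)) (fun _ : Unit => (0, 1)) fun a ha => by
    funext r
    simpa [h] using ha ()
  simp at this
  omega

theorem notMem_K2_zero (h : K.loopPairing φ 0 ψ 0 ≠ 0) : K ∉ K2 0 := by
  intro hK
  obtain ⟨D, rfl, hD⟩ := exists_of_mem_K2 hK
  have := card_tangleCircle_le D (fun _ : Unit => φ) (fun _ : Unit => ψ) fun a ha => by
    funext r
    simpa [h] using ha ()
  simp at this
  omega

/-- The pairing is alternating, so its matrix on `φ, ψ` is a nonzero multiple of the standard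
symplectic one. -/
theorem independent_pair (h : K.loopPairing φ 0 ψ 0 ≠ 0) (a : Fin 2 → ℤ)
    (ha : ∀ s, ∑ r, a r * K.loopPairing (![φ, ψ] r) 0 (![φ, ψ] s) 0 = 0) : a = 0 := by
  have h0 := ha 0
  have h1 := ha 1
  simp only [Fin.sum_univ_two, Matrix.cons_val_zero, Matrix.cons_val_one, loopPairing_self,
    K.loopPairing_antisymm ψ φ, mul_zero, zero_add, add_zero, mul_neg, neg_eq_zero,
    mul_eq_zero, h, or_false] at h0 h1
  funext r
  fin_cases r
  · exact h1
  · exact h0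

/-- Genus 1 allows rank at most 2, but three cycles are independent here: testing against `φ` and
`ψ` kills the coefficients of `ψ` and `φ`, and testing against the whole knot then kills that of
`χ`. -/
theorem notMem_K1_one (h : K.loopPairing φ 0 ψ 0 ≠ 0) (h' : K.loopPairing χ 0 0 1 ≠ 0)
    (h₁ : K.loopPairing φ 0 χ 0 = 0) (h₂ : K.loopPairing ψ 0 χ 0 = 0) : K ∉ K1 1 := by
  intro hK
  obtain ⟨D, rfl, hD⟩ := exists_of_mem_K1 hK
  have := card_closedCircle_le D ![(φ, 0), (ψ, 0), (χ, 0)] ![(φ, 0), (ψ, 0), (0, 1)]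
    fun a ha => by
      have e0 := ha 0
      have e1 := ha 1
      have e2 := ha 2
      simp [Fin.sum_univ_three, loopPairing_self, loopPairing_antisymm ψ φ,
        loopPairing_antisymm χ φ, loopPairing_antisymm χ ψ, h₁, h₂, h] at e0 e1 e2
      simp [e0, e1, h'] at e2
      funext r
      fin_cases r
      · exact e1
      · exact e0
      · exact e2
  simp at this
  omega

end LongVirtualKnot

/-! ### The three infinite families -/

namespace twistDiagram

open LongVirtualKnot LongGaussDiagram GaussWord

variable {N : ℕ} (hN : N % 2 = 1)

theorem annulus_mem : (twistDiagram N 1 0 hN (.inl rfl)).toKnot ∈ K2 0 \ K1 0 := by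
  refine ⟨toKnot_mem_K2 ?_, notMem_K1_zero (φ := select true (-2)) ?_⟩
  · have h1 := le_card_tangleCircle_annulus (hN := hN)
    -- For genus 0 the upper bound on the number of circles needs no cycles: the empty family
    -- suffices.
    have h2 := LongVirtualKnot.card_tangleCircle_le (twistDiagram N 1 0 hN (.inl rfl))
      (fun r : Empty => r.elim) (fun _ : Unit => 0) fun a _ => funext fun r => r.elim
    simp only [Fintype.card_empty] at h2
    rw [numCrossings] at h2 ⊢
    omega
  · rw [pairing_even_const hN]; omega

theorem pairing_even_last_ne_zero {t : ℕ} (ht : t = 0 ∨ t = 4) :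
    (twistDiagram N (-1) t hN ht).toKnot.loopPairing (select true 2) 0 (select false (-2)) 0
      ≠ 0 := by
  rw [pairing_even_last]; omega

theorem torus_mem : (twistDiagram N (-1) 0 hN (.inl rfl)).toKnot ∈ K1 1 \ K2 0 := by
  have h0 := pairing_even_last_ne_zero hN (.inl rfl)
  refine ⟨toKnot_mem_K1 ?_, notMem_K2_zero h0⟩
  have h1 := le_card_closedCircle_torus (hN := hN)
  -- The two independent cycles that exclude `K2 0` also bound the number of circles from above,
  -- making the genus of this realization exactly 1.
  have h2 := LongVirtualKnot.card_closedCircle_le (twistDiagram N (-1) 0 hN (.inl rfl))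
    (fun r => (![select true 2, select false (-2)] r, 0))
    (fun r => (![select true 2, select false (-2)] r, 0)) (independent_pair h0)
  simp only [Fintype.card_fin] at h2
  rw [numCrossings] at h2 ⊢
  omega

theorem twiceHoledTorus_mem : (twistDiagram N (-1) 4 hN (.inr rfl)).toKnot ∈ K2 1 \ K1 1 := by
  have h0 := pairing_even_last_ne_zero hN (.inr rfl)
  refine ⟨toKnot_mem_K2 ?_, notMem_K1_one h0 (χ := select true (-2)) ?_ (pairing_even_extra hN)
    (pairing_last_extra hN)⟩
  · have h1 := le_card_tangleCircle_torus (hN := hN)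
    have h2 := LongVirtualKnot.card_tangleCircle_le (twistDiagram N (-1) 4 hN (.inr rfl))
      ![select true 2, select false (-2)] ![select true 2, select false (-2)]
      (independent_pair h0)
    simp only [Fintype.card_fin] at h2
    rw [numCrossings] at h2 ⊢
    omega
  · rw [pairing_extra_const]; norm_num

theorem odd_mod_two (k : ℕ) : (2 * k + 1) % 2 = 1 := by omega

theorem infinite_K2_zero_diff_K1_zero : (LongVirtualKnot.K2 0 \ LongVirtualKnot.K1 0).Infinite := by
  refine Set.infinite_of_injective_forall_mem (fun k l h => ?_)
    fun k => annulus_mem (odd_mod_two k)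
  have := congrArg (LongVirtualKnot.loopPairing (select true (-2)) 0 0 1) h
  simp only [pairing_even_const] at this
  omega

theorem infinite_K1_one_diff_K2_zero : (LongVirtualKnot.K1 1 \ LongVirtualKnot.K2 0).Infinite := by
  refine Set.infinite_of_injective_forall_mem (fun k l h => ?_)
    fun k => torus_mem (odd_mod_two k)
  have := congrArg (LongVirtualKnot.loopPairing (select true 2) 0 (select false (-2)) 0) h
  simp only [pairing_even_last] at this
  omega

theorem infinite_K2_one_diff_K1_one : (LongVirtualKnot.K2 1 \ LongVirtualKnot.K1 1).Infinite := by
  refine Set.infinite_of_injective_forall_mem (fun k l h => ?_)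
    fun k => twiceHoledTorus_mem (odd_mod_two k)
  -- The pairing detecting the torus part depends on `N` and is unaffected by the appended annular
  -- summand.
  have := congrArg (LongVirtualKnot.loopPairing (select true 2) 0 (select false (-2)) 0) h
  simp only [pairing_even_last] at this
  omega

end twistDiagram

theorem theorem3p8 :
    (LongVirtualKnot.K1 0 ≠ LongVirtualKnot.K2 0 ∧
      LongVirtualKnot.K2 0 ≠ LongVirtualKnot.K1 1 ∧
      LongVirtualKnot.K1 1 ≠ LongVirtualKnot.K2 1) ∧
    (LongVirtualKnot.K2 0 \ LongVirtualKnot.K1 0).Infinite ∧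
    (LongVirtualKnot.K1 1 \ LongVirtualKnot.K2 0).Infinite ∧
    (LongVirtualKnot.K2 1 \ LongVirtualKnot.K1 1).Infinite := by
  refine ⟨⟨fun h => ?_, fun h => ?_, fun h => ?_⟩, twistDiagram.infinite_K2_zero_diff_K1_zero,
    twistDiagram.infinite_K1_one_diff_K2_zero, twistDiagram.infinite_K2_one_diff_K1_one⟩
  · exact twistDiagram.infinite_K2_zero_diff_K1_zero (by
      rw [h, Set.sdiff_self]; exact Set.finite_empty)
  · exact twistDiagram.infinite_K1_one_diff_K2_zero (by
      rw [h, Set.sdiff_self]; exact Set.finite_empty)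
  · exact twistDiagram.infinite_K2_one_diff_K1_one (by
      rw [h, Set.sdiff_self]; exact Set.finite_empty)
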